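/- Let $n\ge 1$ and $m\ge 1$ be integers, let $\alpha>-1$, and let $h\colon\mathbb{R}^n\to\mathbb{R}$ be a solution of $(-\Delta)^{m/2}h=0$ in $\mathbb{R}^n$ in the following distributional sense. For $\varphi$ in the Schwartz space $\mathcal S(\mathbb{R}^n)$ put $(-\Delta)^{m/2}\varphi:=\mathcal F^{-1}\big(|\xi|^m\,\mathcal F\varphi(\xi)\big)$, where $\mathcal F\varphi(\xi)=(2\pi)^{-n/2}\int_{\mathbb{R}^n}\varphi(x)e^{-ix\cdot\xi}\,dx$. If $m$ is even, $h\in L^1_{\mathrm{loc}}(\mathbb{R}^n)$ and $\int_{\mathbb{R}^n}h\,(-\Delta)^{m/2}\varphi\,dx=0$ for every $\varphi\in C_c^\infty(\mathbb{R}^n)$. If $m$ is odd, $h\in L_{m/2}(\mathbb{R}^n)$, i.e. $h\in L^1_{\mathrm{loc}}(\mathbb{R}^n)$ and $\int_{\mathbb{R}^n}\frac{|h(x)|}{1+|x|^{n+m}}\,dx<\infty$, and $\int_{\mathbb{R}^n}h\,(-\Delta)^{m/2}\varphi\,dx=0$ for every $\varphi\in\mathcal S(\mathbb{R}^n)$.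 If $m$ is even, assume further that there are a function $u\colon\mathbb{R}^n\to\mathbb{R}$ with $|x|^{n\alpha}e^{nu}\in L^1(\mathbb{R}^n)$ and a constant $C\in\mathbb{R}$ such that $h(x)\le u(x)+C\log(1+|x|)+C$ for almost every $x\in\mathbb{R}^n$. Then $h$ coincides almost everywhere with a polynomial of (total) degree at most $m-1$. -/

import Mathlib

open MeasureTheory
open scoped FourierTransform SchwartzMap

/-- The space `L_s(ℝⁿ)`: locally integrable functions `w` with
`∫ |w(x)| / (1 + |x|^(n + 2s)) dx < ∞`. -/
def MemLs {n : ℕ} (s : ℝ) (w : EuclideanSpace ℝ (Fin n) → ℝ) : Prop :=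
  LocallyIntegrable w volume ∧
    Integrable (fun x => |w x| / (1 + ‖x‖ ^ ((n : ℝ) + 2 * s))) volume

/-- `(-Δ)^(σ/2) φ = F⁻¹(|ξ|^σ F φ)` for `φ` in the Schwartz space, where `F` is the Fourier transform
in the angular frequency `ξ`.  Mathlib's `𝓕` has kernel `exp (-2πi x·ζ)`, that is `ξ = 2πζ`,
so that the symbol `|ξ|^σ` is `(2π|ζ|)^σ`. -/
noncomputable def fracLaplacian {n : ℕ} (σ : ℝ) (φ : 𝓢(EuclideanSpace ℝ (Fin n), ℂ)) :
    EuclideanSpace ℝ (Fin n) → ℂ :=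
  𝓕⁻ (fun ζ : EuclideanSpace ℝ (Fin n) =>
    (((2 * Real.pi * ‖ζ‖) ^ σ : ℝ) : ℂ) * 𝓕 (φ : EuclideanSpace ℝ (Fin n) → ℂ) ζ)

/-- `u` is a solution of `(-Δ)^(m/2) u = f` in `ℝⁿ`.  For `m` even, `u` is locally integrable and the
equation is tested against `C_c^∞(ℝⁿ)`, that is, against the compactly supported Schwartz functions;
for `m` odd, `u` lies in `L_{m/2}(ℝⁿ)` and the equation is tested against all Schwartz functions. -/
def IsSolution {n : ℕ} (m : ℕ) (u : EuclideanSpace ℝ (Fin n) → ℝ)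
    (f : 𝓢'(EuclideanSpace ℝ (Fin n), ℂ)) : Prop :=
  (Even m → LocallyIntegrable u volume ∧
    ∀ φ : 𝓢(EuclideanSpace ℝ (Fin n), ℂ), HasCompactSupport φ →
      ∫ x, (u x : ℂ) * fracLaplacian (m : ℝ) φ x = f φ) ∧
  (Odd m → MemLs ((m : ℝ) / 2) u ∧
    ∀ φ : 𝓢(EuclideanSpace ℝ (Fin n), ℂ),
      ∫ x, (u x : ℂ) * fracLaplacian (m : ℝ) φ x = f φ)

/-!
Write `T ψ = ∫ h ψ`. The proof has two halves.

**A Liouville theorem under the sharp growth condition.** Suppose `|h| / (1 + |x|) ^ (n + m)` is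
integrable and `T ((-Δ)^(m/2) φ) = 0` for all Schwartz `φ`
(`exists_polynomial_of_fracLaplacian_eq_zero`). If the Fourier transform of a Schwartz function
vanishes near the origin, it can be divided by `|ξ| ^ m`, so `T` annihilates that function
(`exists_fracLaplacian_eq_sub_convolution`). Let now `ψ` be any Schwartz function whose moments of
order `< m` vanish, and split off its low frequencies `ψ ⋆ κ_ε`, with `κ_ε x = ε ^ n κ (ε x)` and
`𝓕 κ = 1` near `0`. The vanishing moments remove the Taylor polynomial of `κ_ε` from the
convolution, and the remainder gives
`|ψ ⋆ κ_ε| ≤ C ε ^ (n + m) / (1 + ε |x|) ^ (n + m) = C / (ε⁻¹ + |x|) ^ (n + m)`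
(`norm_convolution_dilate_le`). By dominated convergence `T (ψ ⋆ κ_ε) → 0`, hence `T ψ = 0`
(`integral_mul_eq_zero_of_moments`). So the kernel of `T` contains the common kernel of the finitely
many moment functionals of order `< m`, and `T` is a linear combination of them: `h` is a polynomial
of degree at most `m - 1`. For odd `m` the hypotheses are those of this theorem, with a
comparable weight.

**Growth of polyharmonic functions.** For `m = 2k` a one-sided bound has to be turned into the
growth condition. Put `A_F R = ∫ h(x) F(|x|² / R²) dx` for a smooth profile `F` which vanishes for
large arguments. The operator `L F = 4 t F'' + 2 n F'` is the Laplacian on such radial functions, so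
`A_{L^k F} = 0`. The generator of dilations `E F = n F + 2 t F'` is `L G` for the primitive `G` of
`F / 2`, and commuting it through `L` gives `(R^{-n-2i} A_{L^i F})' = - R^{-n-2i-1} A_{L^{i+1} G}`.
Descending from `i = k` to `i = 0` bounds `A_F R` by `C R ^ (n + 2k - 1)`, a weak form of Pizzetti's
formula (`exists_abs_radialPairing_iterate_le`). The upper bound on `h` controls the integral of its
positive part over balls by `D R ^ (n + 1)` (`exists_integral_posPart_le`), and `|h| = 2 h⁺ - h`
then controls `∫_{B_R} |h|` (`exists_integral_abs_le`). This gives the integrability needed above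
(`integrable_abs_div_of_growth`), and a cutoff argument extends the equation from compactly
supported to all Schwartz test functions (`integral_mul_clm_eq_zero_of_hasCompactSupport`).
-/

section

open scoped ContDiff Laplacian

variable {n : ℕ}

local notation "E" => EuclideanSpace ℝ (Fin n)

/-! ### Frequencies away from the origin -/

/-- Real powers of a function of temperate growth which is bounded away from `0` from below have
temperate growth. -/
theorem Function.HasTemperateGrowth.rpow_const {H : Type*} [NormedAddCommGroup H]
    [NormedSpace ℝ H] {f : H → ℝ} (hf : f.HasTemperateGrowth) {c : ℝ} (hc : 0 < c)
    (hcf : ∀ x, c < f x) (r : ℝ) : (fun x => f x ^ r).HasTemperateGrowth := by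
  have hpos : ∀ y ∈ Set.Ioi c, 0 < y := fun y hy => hc.trans hy
  have hunique : UniqueDiffOn ℝ (Set.Ioi c) := isOpen_Ioi.uniqueDiffOn
  refine Function.HasTemperateGrowth.comp' (g := fun y : ℝ => y ^ r) (t := Set.Ioi c)
    (by rintro - ⟨y, rfl⟩; exact hcf y) hunique
    (contDiffOn_fun_id.rpow_const_of_ne fun x hx => (hpos x hx).ne') ?_ hf
  intro N
  obtain ⟨k, hk⟩ := exists_nat_ge r
  refine ⟨k, ∑ j ∈ Finset.range (N + 1), ‖Polynomial.eval r (descPochhammer ℝ j)‖ *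
    (1 + c ^ (r - j)), Finset.sum_nonneg fun j _ => by positivity, fun j hj x hx => ?_⟩
  have hx0 : 0 < x := hpos x hx
  have h1 : ContDiffAt ℝ j (fun x : ℝ => x ^ r) x :=
    Real.contDiffAt_rpow_const <| Or.inl hx0.ne'
  rw [norm_iteratedFDerivWithin_eq_norm_iteratedDerivWithin,
    iteratedDerivWithin_eq_iteratedDeriv hunique h1 hx, iteratedDeriv_eq_iterate,
    Real.iter_deriv_rpow_const, norm_mul]
  have h2 : ‖x ^ (r - j)‖ ≤ (1 + c ^ (r - j)) * (1 + ‖x‖) ^ k := by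
    have hle : 1 ≤ (1 + ‖x‖) ^ k := one_le_pow₀ (by linarith [norm_nonneg x])
    have hcr : 0 ≤ c ^ (r - j) := by positivity
    rw [Real.norm_of_nonneg (by positivity)]
    rcases le_total 0 (r - j) with h | h
    · have : x ^ (r - j) ≤ (1 + ‖x‖) ^ k := by
        rw [← Real.rpow_natCast, Real.norm_of_nonneg hx0.le]
        exact (Real.rpow_le_rpow hx0.le (by linarith) h).trans
          (Real.rpow_le_rpow_of_exponent_le (by linarith) (by
            have : (0 : ℝ) ≤ j := by positivity
            linarith))
      nlinarith
    · have : x ^ (r - j) ≤ c ^ (r - j) := Real.rpow_le_rpow_of_nonpos hc (le_of_lt hx) h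
      nlinarith
  calc _ ≤ ‖Polynomial.eval r (descPochhammer ℝ j)‖ * ((1 + c ^ (r - j)) * (1 + ‖x‖) ^ k) := by
        gcongr
    _ = (‖Polynomial.eval r (descPochhammer ℝ j)‖ * (1 + c ^ (r - j))) * (1 + ‖x‖) ^ k := by ring
    _ ≤ _ := by
        gcongr
        exact Finset.single_le_sum
          (f := fun j : ℕ => ‖Polynomial.eval r (descPochhammer ℝ j)‖ * (1 + c ^ (r - j)))
          (fun i _ => by positivity) (by simp; omega)

/-- The part of `ψ` left after removing its low frequencies lies in the range of `(-Δ)^(m/2)`: its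
Fourier transform `(1 - 𝓕 κ) 𝓕 ψ` vanishes near the origin and can be divided by `|2πξ| ^ m`. -/
theorem exists_fracLaplacian_eq_sub_convolution (m : ℕ) (ψ κ : 𝓢(E, ℂ)) {ε : ℝ} (hε : 0 < ε)
    (hκ : ∀ ξ : E, ‖ξ‖ ≤ ε → 𝓕 κ ξ = 1) :
    ∃ φ : 𝓢(E, ℂ), fracLaplacian (m : ℝ) φ =
      ψ - SchwartzMap.convolution (ContinuousLinearMap.mul ℂ ℂ) ψ κ := by
  -- `f` equals `|2πξ| ^ 2` where `𝓕 κ` may differ from `1`; the bump keeps it away from `0`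
  -- near the origin, so that its powers have temperate growth.
  let b : ContDiffBump (0 : E) := ⟨ε / 2, ε, by positivity, by linarith⟩
  let f : E → ℝ := fun ξ => (2 * Real.pi) ^ 2 * ‖ξ‖ ^ 2 + b ξ
  have hf : f.HasTemperateGrowth := by
    have hb : (fun x => b x).HasTemperateGrowth :=
      b.hasCompactSupport.hasTemperateGrowth b.contDiff
    have := Function.hasTemperateGrowth_norm_sq E
    fun_prop
  have hb : ∀ ξ : E, ε ≤ ‖ξ‖ → b ξ = 0 := fun ξ h => b.zero_of_le_dist (by simpa using h)
  have hfpos : ∀ ξ, min 1 (((2 * Real.pi) * (ε / 2)) ^ 2) / 2 < f ξ := by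
    intro ξ
    have h0 : 0 < min 1 (((2 * Real.pi) * (ε / 2)) ^ 2) := by positivity
    rcases le_total ‖ξ‖ (ε / 2) with h | h
    · have h1 : b ξ = 1 := b.one_of_mem_closedBall (by simpa using h)
      have : 0 ≤ (2 * Real.pi) ^ 2 * ‖ξ‖ ^ 2 := by positivity
      have := min_le_left 1 (((2 * Real.pi) * (ε / 2)) ^ 2)
      simp only [f, h1]; linarith
    · have h1 : 0 ≤ b ξ := b.nonneg
      have h2 : ((2 * Real.pi) * (ε / 2)) ^ 2 ≤ (2 * Real.pi) ^ 2 * ‖ξ‖ ^ 2 := by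
        rw [← mul_pow]; gcongr
      have := min_le_right 1 (((2 * Real.pi) * (ε / 2)) ^ 2)
      simp only [f]; linarith
  have hfr := hf.rpow_const (by positivity) hfpos (-(m : ℝ) / 2)
  let q : E → ℂ := fun ξ => (1 - 𝓕 κ ξ) * ((f ξ ^ (-(m : ℝ) / 2) : ℝ) : ℂ)
  have hq : q.HasTemperateGrowth := by
    have h1 := (𝓕 κ).hasTemperateGrowth
    have h2 : (fun ξ => ((f ξ ^ (-(m : ℝ) / 2) : ℝ) : ℂ)).HasTemperateGrowth :=
      Function.Complex.hasTemperateGrowth_ofReal.comp hfr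
    exact ((Function.HasTemperateGrowth.const (1 : ℂ)).sub h1).mul h2
  refine ⟨SchwartzMap.fourierMultiplierCLM ℂ q ψ, ?_⟩
  set e := SchwartzMap.convolution (ContinuousLinearMap.mul ℂ ℂ) ψ κ with he
  have key : (fun ζ : E => (((2 * Real.pi * ‖ζ‖) ^ (m : ℝ) : ℝ) : ℂ) *
      𝓕 (SchwartzMap.fourierMultiplierCLM ℂ q ψ : E → ℂ) ζ) = 𝓕 (ψ - e) := by
    ext ζ
    rw [← SchwartzMap.fourier_coe, SchwartzMap.fourierMultiplierCLM_apply,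
      FourierTransform.fourier_fourierInv_eq, SchwartzMap.smulLeftCLM_apply_apply hq,
      show 𝓕 (ψ - e) = 𝓕 ψ - 𝓕 e from map_sub (FourierTransform.fourierCLM ℂ 𝓢(E, ℂ)) ψ e, he,
      SchwartzMap.fourier_convolution]
    simp only [sub_apply, SchwartzMap.pairing_apply_apply, smul_eq_mul, q,
      ContinuousLinearMap.mul_apply']
    rcases le_total ‖ζ‖ ε with h | h
    · rw [hκ ζ h]; ring
    · have hζ : 0 < 2 * Real.pi * ‖ζ‖ := by
        have := hε.trans_le h
        positivity
      have : (2 * Real.pi * ‖ζ‖) ^ (m : ℝ) * f ζ ^ (-(m : ℝ) / 2) = 1 := by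
        simp only [f, hb ζ h, add_zero]
        rw [← mul_pow, ← Real.rpow_natCast _ 2, ← Real.rpow_mul hζ.le, ← Real.rpow_add hζ]
        convert Real.rpow_zero _ using 2
        push_cast; ring
      have h2 : (((2 * Real.pi * ‖ζ‖) ^ (m : ℝ) : ℝ) : ℂ) *
          ((f ζ ^ (-(m : ℝ) / 2) : ℝ) : ℂ) = 1 := by
        exact_mod_cast this
      linear_combination (1 - 𝓕 κ ζ) * (𝓕 ψ ζ) * h2
  rw [fracLaplacian, key, ← SchwartzMap.fourierInv_coe, FourierTransform.fourierInv_fourier_eq]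
  rfl

/-! ### Taylor expansion and moments of Schwartz functions -/

theorem SchwartzMap.integrable_norm_mul_one_add_norm_pow (ψ : 𝓢(E, ℂ)) (k : ℕ) :
    Integrable (fun y => ‖ψ y‖ * (1 + ‖y‖) ^ k) := by
  refine Integrable.mono' (((ψ.integrable.norm).add (ψ.integrable_pow_mul volume k)).const_mul
    (2 ^ (k - 1))) (by have := ψ.continuous; fun_prop) (ae_of_all _ fun y => ?_)
  have h := add_pow_le zero_le_one (norm_nonneg y) k
  rw [Real.norm_of_nonneg (by positivity)]
  calc ‖ψ y‖ * (1 + ‖y‖) ^ k ≤ ‖ψ y‖ * (2 ^ (k - 1) * (1 ^ k + ‖y‖ ^ k)) := by gcongr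
    _ = _ := by simp only [Pi.add_apply]; ring

theorem SchwartzMap.integrable_mul_prod_coord (ψ : 𝓢(E, ℂ)) {j : ℕ} (i : Fin j → Fin n) :
    Integrable (fun y => ψ y * ((∏ l, y (i l) : ℝ) : ℂ)) := by
  refine Integrable.mono' (ψ.integrable_norm_mul_one_add_norm_pow j)
    (by have := ψ.continuous; fun_prop) (ae_of_all _ fun y => ?_)
  rw [norm_mul, Complex.norm_real, norm_prod]
  gcongr
  calc ∏ l, ‖y (i l)‖ ≤ ∏ _l : Fin j, (1 + ‖y‖) := by
        gcongr with l
        linarith [PiLp.norm_apply_le y (i l)]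
    _ = _ := by simp

/-- If the moments of order `j` of `ψ` vanish, then `ψ` integrates to `0` against every homogeneous
polynomial of degree `j`, here given as the diagonal of a multilinear map. -/
theorem integral_mul_multilinear_diag_eq_zero {ψ : 𝓢(E, ℂ)} {j : ℕ}
    (hψ : ∀ i : Fin j → Fin n, ∫ y, ψ y * ((∏ l, y (i l) : ℝ) : ℂ) = 0)
    (M : ContinuousMultilinearMap ℝ (fun _ : Fin j => E) ℂ) :
    Integrable (fun y => ψ y * M (fun _ => y)) ∧ ∫ y, ψ y * M (fun _ => y) = 0 := by
  have key : (fun y => ψ y * M (fun _ => y)) = fun y => ∑ i : Fin j → Fin n,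
      (ψ y * ((∏ l, y (i l) : ℝ) : ℂ)) * M (fun l => EuclideanSpace.basisFun (Fin n) ℝ (i l)) := by
    ext y
    have h1 : (fun _ : Fin j => y) =
        fun _ => ∑ i, y i • EuclideanSpace.basisFun (Fin n) ℝ i := by
      ext1 _
      simpa using ((EuclideanSpace.basisFun (Fin n) ℝ).sum_repr y).symm
    conv_lhs => rw [h1]
    rw [ContinuousMultilinearMap.map_sum, Finset.mul_sum]
    refine Finset.sum_congr rfl fun i _ => ?_
    rw [ContinuousMultilinearMap.map_smul_univ, Complex.real_smul]
    ring
  rw [key]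
  refine ⟨integrable_finsetSum _ fun i _ => (ψ.integrable_mul_prod_coord i).mul_const _, ?_⟩
  rw [integral_finsetSum _ fun i _ => (ψ.integrable_mul_prod_coord i).mul_const _]
  refine Finset.sum_eq_zero fun i _ => ?_
  rw [integral_mul_const, hψ, zero_mul]

/-- Taylor's formula at `a` with a remainder that keeps the Schwartz decay in `a`, at the cost of
polynomial growth in the increment `b`. -/
theorem SchwartzMap.exists_norm_sub_taylor_le (κ : 𝓢(E, ℂ)) (m N : ℕ) :
    ∃ C, 0 ≤ C ∧ ∀ a b : E, ‖κ (a - b) - ∑ j ∈ Finset.range (m + 1),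
      (Nat.factorial j : ℝ)⁻¹ • iteratedFDeriv ℝ j κ a (fun _ => -b)‖ ≤
        C * ‖b‖ ^ (m + 1) * (1 + ‖b‖) ^ N / (1 + ‖a‖) ^ N := by
  set C : ℝ := 2 ^ N * (Finset.Iic (N, m + 1)).sup
    (fun m => SchwartzMap.seminorm ℝ m.1 m.2) κ with hC
  have hdecay : ∀ x : E, (1 + ‖x‖) ^ N * ‖iteratedFDeriv ℝ (m + 1) κ x‖ ≤ C := fun x =>
    SchwartzMap.one_add_le_sup_seminorm_apply (𝕜 := ℝ) (m := (N, m + 1)) le_rfl le_rfl κ x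
  have hC0 : 0 ≤ C := le_trans (by positivity) (hdecay 0)
  refine ⟨C, hC0, fun a b => ?_⟩
  have hT := map_add_eq_sum_add_integral_iteratedFDeriv (f := κ) (x := a) (y := -b) (n := m)
    (fun t _ => (κ.smooth ⊤).contDiffAt.of_le (mod_cast le_top))
  rw [sub_eq_add_neg a b, hT, add_sub_cancel_left]
  set K : ℝ := C * ‖b‖ ^ (m + 1) * (1 + ‖b‖) ^ N / (1 + ‖a‖) ^ N
  have hK : 0 ≤ K := by positivity
  have hint : ‖∫ t in (0 : ℝ)..1, (1 - t) ^ m • iteratedFDeriv ℝ (m + 1) κ (a + t • -b)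
      (fun _ => -b)‖ ≤ K * |1 - 0| := by
    refine intervalIntegral.norm_integral_le_of_norm_le_const fun t ht => ?_
    rw [Set.uIoc_of_le zero_le_one] at ht
    have h1 : ‖(1 - t) ^ m‖ ≤ 1 := by
      rw [norm_pow]
      exact pow_le_one₀ (norm_nonneg _) (by rw [Real.norm_of_nonneg] <;> linarith [ht.1, ht.2])
    -- The decay at `a + t • -b` is traded for decay at `a`.
    have h2 : 1 + ‖a‖ ≤ (1 + ‖a + t • -b‖) * (1 + ‖b‖) := by
      have h3 : ‖a‖ ≤ ‖a + t • -b‖ + ‖b‖ := by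
        calc ‖a‖ = ‖(a + t • -b) + t • b‖ := by simp
          _ ≤ ‖a + t • -b‖ + ‖t • b‖ := norm_add_le _ _
          _ ≤ _ := by
            gcongr
            rw [norm_smul, Real.norm_of_nonneg ht.1.le]
            exact mul_le_of_le_one_left (norm_nonneg _) ht.2
      nlinarith [norm_nonneg (a + t • -b), norm_nonneg b]
    have h4 : ‖iteratedFDeriv ℝ (m + 1) κ (a + t • -b)‖ ≤ C * (1 + ‖b‖) ^ N / (1 + ‖a‖) ^ N := by
      rw [le_div_iff₀ (by positivity)]
      calc _ ≤ ‖iteratedFDeriv ℝ (m + 1) κ (a + t • -b)‖ *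
            ((1 + ‖a + t • -b‖) * (1 + ‖b‖)) ^ N := by gcongr
        _ = ((1 + ‖a + t • -b‖) ^ N * ‖iteratedFDeriv ℝ (m + 1) κ (a + t • -b)‖) *
            (1 + ‖b‖) ^ N := by rw [mul_pow]; ring
        _ ≤ _ := by gcongr; exact hdecay _
    calc _ ≤ 1 * (‖iteratedFDeriv ℝ (m + 1) κ (a + t • -b)‖ * ‖b‖ ^ (m + 1)) := by
          rw [norm_smul]
          gcongr
          refine (ContinuousMultilinearMap.le_opNorm _ _).trans (le_of_eq ?_)
          simp
      _ ≤ 1 * (C * (1 + ‖b‖) ^ N / (1 + ‖a‖) ^ N * ‖b‖ ^ (m + 1)) := by gcongr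
      _ = K := by simp only [K]; ring
  rw [norm_smul]
  have hf : ‖(Nat.factorial m : ℝ)⁻¹‖ ≤ 1 := by
    rw [norm_inv, Real.norm_natCast]
    exact inv_le_one_of_one_le₀ (mod_cast Nat.factorial_pos m)
  calc _ ≤ 1 * (K * |1 - 0|) := by gcongr
    _ = K := by simp

/-- The dilation `x ↦ ε ^ n κ (ε x)`, normalised so as to preserve the integral for `ε > 0`. -/
noncomputable def SchwartzMap.dilate (κ : 𝓢(E, ℂ)) (ε : ℝ) (hε : ε ≠ 0) : 𝓢(E, ℂ) :=
  (ε ^ n : ℝ) • SchwartzMap.compCLMOfContinuousLinearEquiv ℝ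
    (ContinuousLinearEquiv.smulLeft (M₁ := E) (R₁ := ℝ) (Units.mk0 ε hε)) κ

theorem SchwartzMap.dilate_apply (κ : 𝓢(E, ℂ)) {ε : ℝ} (hε : ε ≠ 0) (x : E) :
    κ.dilate ε hε x = (ε ^ n : ℝ) * κ (ε • x) := by
  simp [SchwartzMap.dilate]

theorem SchwartzMap.fourier_dilate (κ : 𝓢(E, ℂ)) {ε : ℝ} (hε : 0 < ε) (ξ : E) :
    𝓕 (κ.dilate ε hε.ne') ξ = 𝓕 κ (ε⁻¹ • ξ) := by
  rw [SchwartzMap.fourier_coe, SchwartzMap.fourier_coe, Real.fourier_eq, Real.fourier_eq]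
  have h := Measure.integral_comp_smul_of_nonneg (volume : Measure E)
    (fun v => Real.fourierChar (-inner ℝ v (ε⁻¹ • ξ)) • κ v) ε (hR := hε.le)
  rw [finrank_euclideanSpace_fin, eq_inv_smul_iff₀ (by positivity), ← integral_smul] at h
  rw [← h]
  refine integral_congr_ae (ae_of_all _ fun v => ?_)
  simp only [κ.dilate_apply, real_inner_smul_left, real_inner_smul_right, Circle.smul_def,
    smul_eq_mul, Complex.real_smul]
  rw [inv_mul_cancel_left₀ hε.ne']
  push_cast
  ring

/-! ### Low frequencies -/

/-- If the moments of `ψ` of order at most `m` vanish, its low-frequency part is small and spread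
out over the scale `ε⁻¹`: the Taylor polynomial of degree `m` of the dilated kernel integrates to
`0` against `ψ`. -/
theorem norm_convolution_dilate_le {m : ℕ} {ψ : 𝓢(E, ℂ)}
    (hψ : ∀ j < m + 1, ∀ i : Fin j → Fin n, ∫ y, ψ y * ((∏ l, y (i l) : ℝ) : ℂ) = 0)
    (κ : 𝓢(E, ℂ)) (N : ℕ) :
    ∃ C, 0 ≤ C ∧ ∀ (ε : ℝ) (hε : 0 < ε), ε ≤ 1 → ∀ x : E,
      ‖SchwartzMap.convolution (ContinuousLinearMap.mul ℂ ℂ) ψ (κ.dilate ε hε.ne') x‖ ≤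
        C * ε ^ (n + (m + 1)) / (1 + ε * ‖x‖) ^ N := by
  obtain ⟨C, hC, hT⟩ := κ.exists_norm_sub_taylor_le m N
  have hint := ψ.integrable_norm_mul_one_add_norm_pow (m + 1 + N)
  set I := ∫ y, ‖ψ y‖ * (1 + ‖y‖) ^ (m + 1 + N)
  have hI : 0 ≤ I := integral_nonneg fun y => by positivity
  refine ⟨C * I, by positivity, fun ε hε hε1 x => ?_⟩
  rw [SchwartzMap.convolution_apply]
  simp only [convolution, ContinuousLinearMap.mul_apply', κ.dilate_apply]
  let P : E → ℂ := fun y => ∑ j ∈ Finset.range (m + 1),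
      (Nat.factorial j : ℝ)⁻¹ • iteratedFDeriv ℝ j κ (ε • x) (fun _ => -(ε • y))
  have hPeq : ∀ y, ψ y * P y = ∑ j ∈ Finset.range (m + 1),
      (ψ y * iteratedFDeriv ℝ j κ (ε • x) (fun _ => y)) *
        (((Nat.factorial j : ℝ)⁻¹ * (-ε) ^ j : ℝ) : ℂ) := by
    intro y
    simp only [P, Finset.mul_sum]
    refine Finset.sum_congr rfl fun j _ => ?_
    have : (fun _ : Fin j => -(ε • y)) = fun _ => (-ε) • y := by simp
    rw [this, ContinuousMultilinearMap.map_smul_univ (c := fun _ => -ε) (m := fun _ => y)]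
    simp only [Finset.prod_const, Finset.card_univ, Fintype.card_fin, Complex.real_smul]
    push_cast
    ring
  have hMom : ∀ j ∈ Finset.range (m + 1),
      Integrable (fun y => ψ y * iteratedFDeriv ℝ j κ (ε • x) (fun _ => y)) ∧
      ∫ y, ψ y * iteratedFDeriv ℝ j κ (ε • x) (fun _ => y) = 0 := fun j hj =>
    integral_mul_multilinear_diag_eq_zero (hψ j (Finset.mem_range.1 hj)) _
  have hP : Integrable (fun y => ψ y * P y) ∧ ∫ y, ψ y * P y = 0 := by
    simp only [hPeq]
    refine ⟨integrable_finsetSum _ fun j hj => (hMom j hj).1.mul_const _, ?_⟩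
    rw [integral_finsetSum _ fun j hj => (hMom j hj).1.mul_const _]
    refine Finset.sum_eq_zero fun j hj => ?_
    rw [integral_mul_const, (hMom j hj).2, zero_mul]
  have hκ : Integrable (fun y => ψ y * κ (ε • (x - y))) := by
    refine ψ.integrable.mul_bdd (c := SchwartzMap.seminorm ℝ 0 0 κ) ?_
      (ae_of_all _ fun y => SchwartzMap.norm_le_seminorm ℝ κ _)
    have := κ.continuous
    fun_prop
  have heq : ∫ y, ψ y * (((ε ^ n : ℝ) : ℂ) * κ (ε • (x - y))) =
      ((ε ^ n : ℝ) : ℂ) * ∫ y, ψ y * (κ (ε • x - ε • y) - P y) := by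
    simp only [mul_sub, ← smul_sub]
    rw [integral_sub hκ hP.1, hP.2, sub_zero, ← integral_const_mul]
    congr 1; ext y; ring
  rw [heq, norm_mul, Complex.norm_real, Real.norm_of_nonneg (by positivity)]
  have hx : ‖ε • x‖ = ε * ‖x‖ := by rw [norm_smul, Real.norm_of_nonneg hε.le]
  have hbd : ∀ y, ‖ψ y * (κ (ε • x - ε • y) - P y)‖ ≤
      (C * ε ^ (m + 1) / (1 + ε * ‖x‖) ^ N) * (‖ψ y‖ * (1 + ‖y‖) ^ (m + 1 + N)) := by
    intro y
    rw [norm_mul]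
    have hy : ‖ε • y‖ = ε * ‖y‖ := by rw [norm_smul, Real.norm_of_nonneg hε.le]
    have hy1 : ε * ‖y‖ ≤ ‖y‖ := mul_le_of_le_one_left (norm_nonneg y) hε1
    calc _ ≤ ‖ψ y‖ * (C * (ε * ‖y‖) ^ (m + 1) * (1 + ε * ‖y‖) ^ N / (1 + ε * ‖x‖) ^ N) := by
          gcongr
          have := hT (ε • x) (ε • y)
          rwa [hx, hy] at this
      _ ≤ ‖ψ y‖ * (C * (ε * (1 + ‖y‖)) ^ (m + 1) * (1 + ‖y‖) ^ N / (1 + ε * ‖x‖) ^ N) := by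
          gcongr
          linarith
      _ = _ := by rw [mul_pow, pow_add (1 + ‖y‖)]; ring
  calc _ ≤ ε ^ n * ∫ y, (C * ε ^ (m + 1) / (1 + ε * ‖x‖) ^ N) *
        (‖ψ y‖ * (1 + ‖y‖) ^ (m + 1 + N)) := by
        gcongr
        exact norm_integral_le_of_norm_le (hint.const_mul _) (ae_of_all _ hbd)
    _ = _ := by rw [integral_const_mul, pow_add ε n]; ring

theorem integrable_mul_schwartz {h : E → ℝ} {N : ℕ} (hmeas : AEStronglyMeasurable h volume)
    (hI : Integrable (fun x => |h x| / (1 + ‖x‖) ^ N)) (ψ : 𝓢(E, ℂ)) :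
    Integrable (fun x => (h x : ℂ) * ψ x) := by
  refine Integrable.mono' (hI.mul_const (2 ^ N * (Finset.Iic (N, 0)).sup
    (fun m => SchwartzMap.seminorm ℝ m.1 m.2) ψ))
    ((Complex.continuous_ofReal.comp_aestronglyMeasurable hmeas).mul
      ψ.continuous.aestronglyMeasurable) (ae_of_all _ fun x => ?_)
  have h1 := SchwartzMap.one_add_le_sup_seminorm_apply (𝕜 := ℝ) (m := (N, 0)) le_rfl le_rfl ψ x
  rw [norm_iteratedFDeriv_zero] at h1
  rw [norm_mul, Complex.norm_real, Real.norm_eq_abs, div_mul_eq_mul_div,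
    le_div_iff₀ (by positivity)]
  calc _ = |h x| * ((1 + ‖x‖) ^ N * ‖ψ x‖) := by ring
    _ ≤ _ := by gcongr

/-- Integration against `h` as a tempered distribution, for `h` integrable against some power of
`(1 + ‖x‖)⁻¹`. -/
noncomputable def schwartzFunctional {h : E → ℝ} {N : ℕ} (hmeas : AEStronglyMeasurable h volume)
    (hI : Integrable (fun x => |h x| / (1 + ‖x‖) ^ N)) : 𝓢(E, ℂ) →L[ℂ] ℂ :=
  SchwartzMap.mkCLMtoNormedSpace (fun ψ => ∫ x, (h x : ℂ) * ψ x)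
    (fun ψ₁ ψ₂ => by
        simp only [add_apply, mul_add]
        exact integral_add (integrable_mul_schwartz hmeas hI ψ₁)
          (integrable_mul_schwartz hmeas hI ψ₂))
    (fun c ψ => by
        simp only [smul_apply, smul_eq_mul, RingHom.id_apply, mul_left_comm _ c]
        exact integral_const_mul _ _)
    (by
      refine ⟨Finset.Iic (N, 0), (∫ x, |h x| / (1 + ‖x‖) ^ N) * 2 ^ N,
        mul_nonneg (integral_nonneg fun x => by positivity) (by positivity), fun ψ => ?_⟩
      rw [mul_assoc, ← integral_mul_const]
      refine norm_integral_le_of_norm_le (hI.mul_const _) (ae_of_all _ fun x => ?_)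
      have h1 := SchwartzMap.one_add_le_sup_seminorm_apply (𝕜 := ℂ) (m := (N, 0)) le_rfl le_rfl ψ x
      rw [norm_iteratedFDeriv_zero] at h1
      rw [norm_mul, Complex.norm_real, Real.norm_eq_abs, div_mul_eq_mul_div,
        le_div_iff₀ (by positivity)]
      calc _ = |h x| * ((1 + ‖x‖) ^ N * ‖ψ x‖) := by ring
        _ ≤ _ := mul_le_mul_of_nonneg_left h1 (abs_nonneg _))

variable (n) in
theorem exists_schwartz_fourier_eq_one :
    ∃ κ : 𝓢(E, ℂ), ∀ ξ, ‖ξ‖ ≤ 1 → 𝓕 κ ξ = 1 := by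
  let b : ContDiffBump (0 : E) := ⟨1, 2, by norm_num, by norm_num⟩
  have hs : HasCompactSupport (fun x => (b x : ℂ)) :=
    b.hasCompactSupport.comp_left (g := fun r : ℝ => (r : ℂ)) Complex.ofReal_zero
  have hd : ContDiff ℝ ∞ (fun x => (b x : ℂ)) :=
    Complex.ofRealCLM.contDiff.comp b.contDiff
  refine ⟨𝓕⁻ (hs.toSchwartzMap hd), fun ξ hξ => ?_⟩
  rw [FourierTransform.fourier_fourierInv_eq]
  simp [b.one_of_mem_closedBall (show ξ ∈ Metric.closedBall 0 b.rIn by simpa using hξ)]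

/-- A solution of `(-Δ)^((m+1)/2) h = 0` annihilates the Schwartz functions with vanishing moments
of order at most `m`. -/
theorem integral_mul_eq_zero_of_moments {h : E → ℝ} {m : ℕ}
    (hmeas : AEStronglyMeasurable h volume)
    (hI : Integrable (fun x => |h x| / (1 + ‖x‖) ^ (n + (m + 1))))
    (hT : ∀ φ : 𝓢(E, ℂ), ∫ x, (h x : ℂ) * fracLaplacian ((m + 1 : ℕ) : ℝ) φ x = 0)
    {ψ : 𝓢(E, ℂ)}
    (hψ : ∀ j < m + 1, ∀ i : Fin j → Fin n, ∫ y, ψ y * ((∏ l, y (i l) : ℝ) : ℂ) = 0) :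
    ∫ x, (h x : ℂ) * ψ x = 0 := by
  obtain ⟨κ, hκ⟩ := exists_schwartz_fourier_eq_one n
  obtain ⟨C, hC, hbd⟩ := norm_convolution_dilate_le hψ κ (n + (m + 1))
  have key : ∀ k : ℕ, ‖∫ x, (h x : ℂ) * ψ x‖ ≤
      C * ∫ x, |h x| / ((k : ℝ) + 1 + ‖x‖) ^ (n + (m + 1)) := by
    intro k
    have hk : (0 : ℝ) < (k : ℝ) + 1 := by positivity
    set ε : ℝ := ((k : ℝ) + 1)⁻¹ with hε
    have hε0 : 0 < ε := by positivity
    have hε1 : ε ≤ 1 := inv_le_one_of_one_le₀ (by linarith [(Nat.cast_nonneg k : (0 : ℝ) ≤ k)])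
    obtain ⟨φ, hφ⟩ := exists_fracLaplacian_eq_sub_convolution (m + 1) ψ (κ.dilate ε hε0.ne') hε0
      (fun ξ hξ => by
        rw [SchwartzMap.fourier_dilate κ hε0]
        apply hκ
        rw [norm_smul, norm_inv, Real.norm_of_nonneg hε0.le, inv_mul_le_iff₀ hε0, mul_one]
        exact hξ)
    set e := SchwartzMap.convolution (ContinuousLinearMap.mul ℂ ℂ) ψ (κ.dilate ε hε0.ne')
    have h0 := hT φ
    rw [hφ] at h0
    simp only [Pi.sub_apply, mul_sub] at h0
    rw [integral_sub (integrable_mul_schwartz hmeas hI ψ) (integrable_mul_schwartz hmeas hI e),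
      sub_eq_zero] at h0
    rw [h0, ← integral_const_mul]
    refine norm_integral_le_of_norm_le ?_ (ae_of_all _ fun x => ?_)
    · refine (Integrable.mono' hI ?_ (ae_of_all _ fun x => ?_)).const_mul C
      · exact (hmeas.norm.aemeasurable.div (by fun_prop)).aestronglyMeasurable
      · rw [Real.norm_of_nonneg (by positivity)]
        gcongr
        linarith
    · rw [norm_mul, Complex.norm_real, Real.norm_eq_abs]
      calc _ ≤ |h x| * (C * ε ^ (n + (m + 1)) / (1 + ε * ‖x‖) ^ (n + (m + 1))) := by
            gcongr
            exact hbd ε hε0 hε1 x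
        _ = _ := by
            -- The powers of `ε` cancel exactly, since the decay exponent is `n + (m + 1)`.
            have : 1 + ε * ‖x‖ = ε * ((k : ℝ) + 1 + ‖x‖) := by
              rw [hε]; field_simp
            rw [this, mul_pow]
            field_simp
  have hlim : Filter.Tendsto (fun k : ℕ => C * ∫ x, |h x| / ((k : ℝ) + 1 + ‖x‖) ^ (n + (m + 1)))
      Filter.atTop (nhds (C * ∫ _x : E, (0 : ℝ))) := by
    refine Filter.Tendsto.const_mul C ?_
    refine tendsto_integral_of_dominated_convergence _ (fun k => ?_) hI (fun k => ae_of_all _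
      fun x => ?_) (ae_of_all _ fun x => ?_)
    · exact (hmeas.norm.aemeasurable.div (by fun_prop)).aestronglyMeasurable
    · rw [Real.norm_of_nonneg (by positivity)]
      gcongr
      linarith [(Nat.cast_nonneg k : (0 : ℝ) ≤ k)]
    · refine Filter.Tendsto.div_atTop tendsto_const_nhds ?_
      refine (Filter.tendsto_pow_atTop (by omega)).comp ?_
      exact Filter.tendsto_atTop_add_const_right _ _
        (Filter.tendsto_atTop_add_const_right _ _ tendsto_natCast_atTop_atTop)
  simp only [integral_zero, mul_zero] at hlim
  exact norm_le_zero_iff.1 (ge_of_tendsto' hlim key)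

/-! ### Liouville's theorem under a growth condition -/

/-- **Liouville's theorem** for `(-Δ)^((m+1)/2)` among functions integrable against
`(1 + ‖x‖) ^ (-(n + m + 1))`. -/
theorem exists_polynomial_of_fracLaplacian_eq_zero {h : E → ℝ} {m : ℕ}
    (hloc : LocallyIntegrable h volume)
    (hI : Integrable (fun x => |h x| / (1 + ‖x‖) ^ (n + (m + 1))))
    (hT : ∀ φ : 𝓢(E, ℂ), ∫ x, (h x : ℂ) * fracLaplacian ((m + 1 : ℕ) : ℝ) φ x = 0) :
    ∃ p : MvPolynomial (Fin n) ℝ, p.totalDegree ≤ m ∧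
      ∀ᵐ x ∂volume, h x = MvPolynomial.eval (fun i => x i) p := by
  have hmeas := hloc.aestronglyMeasurable
  -- The moments of order at most `m`, indexed by tuples of coordinates.
  let ι := Σ j : Fin (m + 1), (Fin j → Fin n)
  let L : ι → 𝓢(E, ℂ) →ₗ[ℂ] ℂ := fun i =>
    { toFun := fun ψ => ∫ y, ψ y * ((∏ l, y (i.2 l) : ℝ) : ℂ)
      map_add' := fun ψ₁ ψ₂ => by
        simp only [add_apply, add_mul]
        exact integral_add (ψ₁.integrable_mul_prod_coord i.2) (ψ₂.integrable_mul_prod_coord i.2)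
      map_smul' := fun c ψ => by
        simp only [smul_apply, smul_eq_mul, mul_assoc, RingHom.id_apply]
        exact integral_const_mul _ _ }
  let K : 𝓢(E, ℂ) →ₗ[ℂ] ℂ := (schwartzFunctional hmeas hI).toLinearMap
  have hK : K ∈ Submodule.span ℂ (Set.range L) := by
    refine mem_span_of_iInf_ker_le_ker fun ψ hψ => ?_
    simp only [Submodule.mem_iInf, LinearMap.mem_ker] at hψ ⊢
    exact integral_mul_eq_zero_of_moments hmeas hI hT fun j hj i => hψ ⟨⟨j, hj⟩, i⟩
  obtain ⟨c, hc⟩ := (Submodule.mem_span_range_iff_exists_fun ℂ).1 hK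
  let p : MvPolynomial (Fin n) ℝ :=
    ∑ i : ι, MvPolynomial.C (c i).re * ∏ l, MvPolynomial.X (i.2 l)
  have hp : ∀ x : E, MvPolynomial.eval (fun i => x i) p = ∑ i : ι, (c i).re * ∏ l, x (i.2 l) := by
    intro x
    simp [p, map_sum, map_prod]
  refine ⟨p, MvPolynomial.totalDegree_finsetSum_le fun i _ => ?_, ?_⟩
  · refine (MvPolynomial.totalDegree_mul _ _).trans ?_
    rw [MvPolynomial.totalDegree_C, zero_add]
    refine (MvPolynomial.totalDegree_finsetProd _ _).trans ?_
    simp only [MvPolynomial.totalDegree_X, Finset.sum_const, Finset.card_univ, Fintype.card_fin,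
      smul_eq_mul, mul_one]
    exact Nat.lt_succ_iff.1 i.1.2
  · simp only [hp]
    have hcont : Continuous fun x : E => ∑ i : ι, (c i).re * ∏ l, x (i.2 l) := by fun_prop
    refine ae_eq_of_integral_contDiff_smul_eq hloc hcont.locallyIntegrable fun g hg hgs => ?_
    have hs : HasCompactSupport (fun x => (g x : ℂ)) :=
      hgs.comp_left (g := fun r : ℝ => (r : ℂ)) Complex.ofReal_zero
    have hd : ContDiff ℝ ∞ (fun x => (g x : ℂ)) := Complex.ofRealCLM.contDiff.comp hg
    let ψ : 𝓢(E, ℂ) := hs.toSchwartzMap hd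
    have hψ : ∀ x, ψ x = (g x : ℂ) := fun x => rfl
    have hL : ∀ i, L i ψ = ((∫ x, g x * ∏ l, x (i.2 l) : ℝ) : ℂ) := by
      intro i
      rw [← integral_complex_ofReal]
      refine integral_congr_ae (ae_of_all _ fun x => ?_)
      simp [hψ]
    have hKψ : K ψ = ((∫ x, g x • h x : ℝ) : ℂ) := by
      rw [← integral_complex_ofReal]
      refine integral_congr_ae (ae_of_all _ fun x => ?_)
      simp [hψ, mul_comm]
    have h1 := congrArg (fun A : 𝓢(E, ℂ) →ₗ[ℂ] ℂ => (A ψ).re) hc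
    simp only [LinearMap.sum_apply, LinearMap.smul_apply, hL, hKψ, smul_eq_mul, Complex.re_sum,
      Complex.re_mul_ofReal, Complex.ofReal_re] at h1
    simp only [smul_eq_mul]
    rw [← h1]
    simp only [Finset.mul_sum]
    have hint : ∀ i : ι, Integrable fun x : E => g x * ∏ l, x (i.2 l) := by
      intro i
      refine Continuous.integrable_of_hasCompactSupport ?_ hgs.mul_right
      have := hg.continuous
      fun_prop
    rw [integral_finsetSum]
    · refine Finset.sum_congr rfl fun i _ => ?_
      rw [← integral_const_mul]
      refine integral_congr_ae (ae_of_all _ fun x => ?_)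
      ring
    · intro i _
      refine ((hint i).const_mul (c i).re).congr (ae_of_all _ fun x => ?_)
      ring

/-! ### Powers of the Laplacian and compactly supported test functions -/

theorem fracLaplacian_two_mul (k : ℕ) (φ : 𝓢(E, ℂ)) :
    fracLaplacian ((2 * k : ℕ) : ℝ) φ =
      (-1 : ℂ) ^ k • ((LineDeriv.laplacianCLM ℂ E 𝓢(E, ℂ) ^ k) φ : E → ℂ) := by
  have h1 : ∀ (φ : 𝓢(E, ℂ)) (ζ : E), 𝓕 (LineDeriv.laplacianCLM ℂ E 𝓢(E, ℂ) φ) ζ =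
      -((2 * Real.pi * ‖ζ‖ : ℝ) : ℂ) ^ 2 * 𝓕 φ ζ := by
    intro φ ζ
    have h : (fun ξ : E => ‖ξ‖ ^ 2).HasTemperateGrowth := Function.hasTemperateGrowth_norm_sq E
    rw [SchwartzMap.laplacianCLM_eq, SchwartzMap.laplacian_eq_fourierMultiplierCLM,
      show 𝓕 (-(2 * Real.pi) ^ 2 • SchwartzMap.fourierMultiplierCLM ℂ (‖·‖ ^ 2) φ) =
        (-(2 * Real.pi) ^ 2 : ℝ) • 𝓕 (SchwartzMap.fourierMultiplierCLM ℂ (fun ξ : E => ‖ξ‖ ^ 2) φ)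
        from map_smul (FourierTransform.fourierCLM ℝ 𝓢(E, ℂ)) _ _,
      SchwartzMap.fourierMultiplierCLM_apply,
      FourierTransform.fourier_fourierInv_eq, smul_apply,
      SchwartzMap.smulLeftCLM_apply_apply h]
    simp only [Complex.real_smul]
    push_cast
    ring
  have h2 : ∀ ζ : E, 𝓕 ((LineDeriv.laplacianCLM ℂ E 𝓢(E, ℂ) ^ k) φ) ζ =
      (-1) ^ k * (((2 * Real.pi * ‖ζ‖) ^ (2 * k) : ℝ) : ℂ) * 𝓕 φ ζ := by
    intro ζ
    induction k with
    | zero => simp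
    | succ k ih =>
      rw [pow_succ', mul_apply_eq_comp, h1, ih]
      push_cast
      ring
  have h3 : (fun ζ : E => (((2 * Real.pi * ‖ζ‖) ^ ((2 * k : ℕ) : ℝ) : ℝ) : ℂ) *
      𝓕 (φ : E → ℂ) ζ) = 𝓕 ((-1 : ℂ) ^ k • (LineDeriv.laplacianCLM ℂ E 𝓢(E, ℂ) ^ k) φ) := by
    ext ζ
    rw [show 𝓕 ((-1 : ℂ) ^ k • (LineDeriv.laplacianCLM ℂ E 𝓢(E, ℂ) ^ k) φ) =
      (-1 : ℂ) ^ k • 𝓕 ((LineDeriv.laplacianCLM ℂ E 𝓢(E, ℂ) ^ k) φ) from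
      map_smul (FourierTransform.fourierCLM ℂ 𝓢(E, ℂ)) _ _, smul_apply, h2, Real.rpow_natCast,
      ← SchwartzMap.fourier_coe, smul_eq_mul, ← mul_assoc, ← mul_assoc, ← mul_pow]
    simp
  rw [fracLaplacian, h3, ← SchwartzMap.fourierInv_coe, FourierTransform.fourierInv_fourier_eq]
  rfl

/-- Compactly supported functions are sequentially dense in the Schwartz space. -/
theorem SchwartzMap.exists_tendsto_hasCompactSupport (φ : 𝓢(E, ℂ)) :
    ∃ u : ℕ → 𝓢(E, ℂ), (∀ k, HasCompactSupport (u k)) ∧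
      Filter.Tendsto u Filter.atTop (nhds φ) := by
  let b : ContDiffBump (0 : E) := ⟨1, 2, by norm_num, by norm_num⟩
  have hs : HasCompactSupport (fun x => (b x : ℂ)) :=
    b.hasCompactSupport.comp_left (g := fun r : ℝ => (r : ℂ)) Complex.ofReal_zero
  have hd : ContDiff ℝ ∞ (fun x => (b x : ℂ)) :=
    Complex.ofRealCLM.contDiff.comp b.contDiff
  let χ : 𝓢(E, ℂ) := hs.toSchwartzMap hd
  have hχ1 : ∀ x : E, ‖x‖ ≤ 1 → χ x = 1 := fun x hx => by
    simp [χ, b.one_of_mem_closedBall (show x ∈ Metric.closedBall 0 b.rIn by simpa using hx)]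
  let r : ℕ → ℝ := fun k => ((k : ℝ) + 1)⁻¹
  have hr0 : ∀ k, 0 < r k := fun k => by positivity
  have hr1 : ∀ k, r k ≤ 1 := fun k =>
    inv_le_one_of_one_le₀ (by linarith [(Nat.cast_nonneg k : (0 : ℝ) ≤ k)])
  let X : ℕ → E → ℂ := fun k x => χ (r k • x)
  have hXs : ∀ k, HasCompactSupport (X k) := fun k =>
    hs.comp_smul (hr0 k).ne'
  have hXd : ∀ k, ContDiff ℝ ∞ (X k) := fun k => (χ.smooth ⊤).comp (contDiff_const_smul (r k))
  have hXt : ∀ k, (X k).HasTemperateGrowth := fun k => (hXs k).hasTemperateGrowth (hXd k)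
  have hXn : ∀ k i x, ‖iteratedFDeriv ℝ i (X k) x‖ ≤ SchwartzMap.seminorm ℝ 0 i χ := by
    intro k i x
    have := congrFun (iteratedFDeriv_comp_const_smul (r k)
      ((χ.smooth ⊤).of_le (mod_cast le_top) : ContDiff ℝ i χ)) x
    rw [show X k = fun x => χ (r k • x) from rfl, this, norm_smul, norm_pow,
      Real.norm_of_nonneg (hr0 k).le]
    calc _ ≤ 1 * ‖iteratedFDeriv ℝ i χ (r k • x)‖ := by
          gcongr
          exact pow_le_one₀ (hr0 k).le (hr1 k)
      _ ≤ _ := by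
          rw [one_mul]
          simpa using SchwartzMap.le_seminorm ℝ 0 i χ (r k • x)
  refine ⟨fun k => SchwartzMap.smulLeftCLM ℂ (X k) φ, fun k => ?_, ?_⟩
  · rw [SchwartzMap.smulLeftCLM_apply (hXt k)]
    exact (hXs k).smul_right
  · rw [(schwartz_withSeminorms ℝ E ℂ).tendsto_nhds]
    rintro ⟨a, j⟩ δ hδ
    set B : ℝ := (∑ i ∈ Finset.range (j + 1), (j.choose i : ℝ) * SchwartzMap.seminorm ℝ 0 i χ *
      SchwartzMap.seminorm ℝ (a + 1) (j - i) φ) + SchwartzMap.seminorm ℝ (a + 1) j φ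
    have hB : 0 ≤ B := by positivity
    -- The difference lives on `‖x‖ ≥ (r k)⁻¹`, where an additional factor `‖x‖` gains `r k`.
    have hbound : ∀ k, SchwartzMap.seminorm ℝ a j (SchwartzMap.smulLeftCLM ℂ (X k) φ - φ) ≤
        r k * B := by
      intro k
      refine SchwartzMap.seminorm_le_bound ℝ a j _ (by have := hr0 k; positivity) fun x => ?_
      have hcoe : ((SchwartzMap.smulLeftCLM ℂ (X k) φ - φ : 𝓢(E, ℂ)) : E → ℂ) =
          (fun y => X k y * φ y) - (φ : E → ℂ) := by
        ext y
        simp [SchwartzMap.smulLeftCLM_apply_apply (hXt k)]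
      rw [hcoe]
      rcases lt_or_ge ‖x‖ (r k)⁻¹ with hx | hx
      · have hev : ((fun y => X k y * φ y) - (φ : E → ℂ)) =ᶠ[nhds x] fun _ => 0 := by
          filter_upwards [(isOpen_lt continuous_norm continuous_const).mem_nhds hx] with y hy
          have : X k y = 1 := by
            apply hχ1
            rw [norm_smul, Real.norm_of_nonneg (hr0 k).le]
            have := mul_lt_mul_of_pos_left (show ‖y‖ < (r k)⁻¹ from hy) (hr0 k)
            rw [mul_inv_cancel₀ (hr0 k).ne'] at this
            exact this.le
          simp [this]
        rw [hev.iteratedFDeriv (𝕜 := ℝ) j |>.eq_of_nhds]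
        have : 0 ≤ r k * B := mul_nonneg (hr0 k).le hB
        simpa using this
      · have hx' : 1 ≤ r k * ‖x‖ := by
          have := mul_le_mul_of_nonneg_left hx (hr0 k).le
          rwa [mul_inv_cancel₀ (hr0 k).ne'] at this
        have h1 : ‖iteratedFDeriv ℝ j ((fun y => X k y * φ y) - (φ : E → ℂ)) x‖ ≤
            (∑ i ∈ Finset.range (j + 1), (j.choose i : ℝ) * SchwartzMap.seminorm ℝ 0 i χ *
              ‖iteratedFDeriv ℝ (j - i) φ x‖) + ‖iteratedFDeriv ℝ j φ x‖ := by
          have e1 : ContDiff ℝ j (fun y => X k y * φ y) :=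
            (((hXd k).mul (φ.smooth ⊤))).of_le (mod_cast le_top)
          rw [iteratedFDeriv_sub_apply e1.contDiffAt
            ((φ.smooth ⊤).of_le (mod_cast le_top) : ContDiff ℝ j φ).contDiffAt]
          refine (norm_sub_le _ _).trans ?_
          gcongr
          refine (norm_iteratedFDeriv_mul_le (hXd k) (φ.smooth ⊤) x (mod_cast le_top)).trans ?_
          gcongr
          exact hXn k _ x
        calc _ ≤ ‖x‖ ^ a * ((∑ i ∈ Finset.range (j + 1), (j.choose i : ℝ) *
                SchwartzMap.seminorm ℝ 0 i χ * ‖iteratedFDeriv ℝ (j - i) φ x‖) +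
                ‖iteratedFDeriv ℝ j φ x‖) * 1 := by
              rw [mul_one]; gcongr
          _ ≤ ‖x‖ ^ a * ((∑ i ∈ Finset.range (j + 1), (j.choose i : ℝ) *
                SchwartzMap.seminorm ℝ 0 i χ * ‖iteratedFDeriv ℝ (j - i) φ x‖) +
                ‖iteratedFDeriv ℝ j φ x‖) * (r k * ‖x‖) := by gcongr
          _ = r k * ((∑ i ∈ Finset.range (j + 1), (j.choose i : ℝ) *
                SchwartzMap.seminorm ℝ 0 i χ *
                (‖x‖ ^ (a + 1) * ‖iteratedFDeriv ℝ (j - i) φ x‖)) +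
                ‖x‖ ^ (a + 1) * ‖iteratedFDeriv ℝ j φ x‖) := by
              have : ∀ i, (j.choose i : ℝ) * SchwartzMap.seminorm ℝ 0 i χ *
                (‖x‖ ^ (a + 1) * ‖iteratedFDeriv ℝ (j - i) φ x‖) = ‖x‖ ^ (a + 1) *
                ((j.choose i : ℝ) * SchwartzMap.seminorm ℝ 0 i χ *
                  ‖iteratedFDeriv ℝ (j - i) φ x‖) := fun i => by ring
              simp only [this, ← Finset.mul_sum]
              ring
          _ ≤ r k * B := by
              refine mul_le_mul_of_nonneg_left ?_ (hr0 k).le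
              simp only [B]
              gcongr
              · exact SchwartzMap.le_seminorm ℝ (a + 1) _ φ x
              · exact SchwartzMap.le_seminorm ℝ (a + 1) _ φ x
    have hlim : Filter.Tendsto (fun k => r k * B) Filter.atTop (nhds 0) := by
      simpa [r] using (tendsto_one_div_add_atTop_nhds_zero_nat (𝕜 := ℝ)).mul_const B
    filter_upwards [hlim.eventually (gt_mem_nhds hδ)] with k hk
    exact (hbound k).trans_lt hk

theorem integral_mul_clm_eq_zero_of_hasCompactSupport {h : E → ℝ} {N : ℕ}
    (hmeas : AEStronglyMeasurable h volume) (hI : Integrable (fun x => |h x| / (1 + ‖x‖) ^ N))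
    (A : 𝓢(E, ℂ) →L[ℂ] 𝓢(E, ℂ))
    (hA : ∀ φ : 𝓢(E, ℂ), HasCompactSupport φ → ∫ x, (h x : ℂ) * A φ x = 0) (φ : 𝓢(E, ℂ)) :
    ∫ x, (h x : ℂ) * A φ x = 0 := by
  obtain ⟨u, hu, hlim⟩ := SchwartzMap.exists_tendsto_hasCompactSupport φ
  have h1 := (((schwartzFunctional hmeas hI).comp A).continuous.tendsto φ).comp hlim
  have h2 : ((schwartzFunctional hmeas hI).comp A) ∘ u = fun _ => 0 := by
    ext k
    exact hA (u k) (hu k)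
  rw [h2] at h1
  exact (tendsto_nhds_unique h1 tendsto_const_nhds)

/-! ### The radial Laplacian -/

/-- Smooth profiles of compactly supported radial functions `x ↦ F (c ‖x‖ ^ 2)`. Nothing is required
at negative arguments, which such functions do not see; this makes the class stable under the
primitive vanishing at large arguments. -/
def IsProfile (F : ℝ → ℝ) : Prop :=
  ContDiff ℝ ∞ F ∧ ∃ T, ∀ t, T ≤ t → F t = 0

/-- The Laplacian on radial functions of `n` variables, in terms of the profile as a function of
`t = ‖x‖ ^ 2`. -/
noncomputable def radialLaplacian (n : ℕ) (F : ℝ → ℝ) : ℝ → ℝ :=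
  fun t => 4 * t * deriv (deriv F) t + 2 * n * deriv F t

/-- The operator `n + x · ∇` on radial functions of `n` variables, in terms of the profile as a
function of `t = ‖x‖ ^ 2`. -/
noncomputable def eulerOperator (n : ℕ) (F : ℝ → ℝ) : ℝ → ℝ :=
  fun t => n * F t + 2 * t * deriv F t

theorem contDiff_deriv {F : ℝ → ℝ} (hF : ContDiff ℝ ∞ F) : ContDiff ℝ ∞ (deriv F) :=
  (contDiff_infty_iff_deriv.1 hF).2

theorem ContDiff.radialLaplacian {F : ℝ → ℝ} (hF : ContDiff ℝ ∞ F) :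
    ContDiff ℝ ∞ (radialLaplacian n F) := by
  have h1 := contDiff_deriv hF
  have h2 := contDiff_deriv h1
  unfold _root_.radialLaplacian
  fun_prop

theorem IsProfile.deriv {F : ℝ → ℝ} (hF : IsProfile F) : IsProfile (deriv F) := by
  obtain ⟨h, T, hT⟩ := hF
  refine ⟨contDiff_deriv h, T + 1, fun t ht => ?_⟩
  have : F =ᶠ[nhds t] fun _ => 0 := by
    filter_upwards [lt_mem_nhds (show T < t by linarith)] with s hs using hT s hs.le
  rw [this.deriv_eq, deriv_const]

theorem IsProfile.radialLaplacian {F : ℝ → ℝ} (hF : IsProfile F) :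
    IsProfile (radialLaplacian n F) := by
  obtain ⟨-, T₁, h₁⟩ := hF.deriv
  obtain ⟨-, T₂, h₂⟩ := hF.deriv.deriv
  refine ⟨hF.1.radialLaplacian, max T₁ T₂, fun t ht => ?_⟩
  simp [_root_.radialLaplacian, h₁ t ((le_max_left _ _).trans ht),
    h₂ t ((le_max_right _ _).trans ht)]

theorem IsProfile.iterate_radialLaplacian {F : ℝ → ℝ} (hF : IsProfile F) (i : ℕ) :
    IsProfile ((_root_.radialLaplacian n)^[i] F) := by
  induction i with
  | zero => exact hF
  | succ i ih => rw [Function.iterate_succ_apply']; exact ih.radialLaplacian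

/-- The field `x F(‖x‖ ^ 2)`, whose divergence is the right-hand side, is the gradient of
`G(‖x‖ ^ 2)` for `G` the primitive of `F / 2` which vanishes at large arguments. -/
theorem IsProfile.exists_radialLaplacian_eq_eulerOperator (n : ℕ) {F : ℝ → ℝ} (hF : IsProfile F) :
    ∃ G, IsProfile G ∧ _root_.radialLaplacian n G = eulerOperator n F := by
  obtain ⟨h, T, hT⟩ := hF
  let G : ℝ → ℝ := fun t => ∫ s in T..t, F s / 2
  have hc : Continuous fun s => F s / 2 := by have := h.continuous; fun_prop
  have hG : ∀ t, HasDerivAt G (F t / 2) t := fun t =>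
    intervalIntegral.integral_hasDerivAt_right (hc.intervalIntegrable _ _)
      (hc.stronglyMeasurableAtFilter _ _) hc.continuousAt
  have hG' : _root_.deriv G = fun t => F t / 2 := funext fun t => (hG t).deriv
  refine ⟨G, ⟨contDiff_infty_iff_deriv.2 ⟨fun t => (hG t).differentiableAt, ?_⟩, T,
    fun t ht => ?_⟩, ?_⟩
  · rw [hG']; fun_prop
  · refine intervalIntegral.integral_zero_ae (ae_of_all _ fun s hs => ?_)
    rw [Set.uIoc_of_le ht] at hs
    simp [hT s hs.1.le]
  · ext t
    simp only [_root_.radialLaplacian, eulerOperator, hG', deriv_div_const]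
    ring

/-- The commutation relation `L (E + c) = (E + c + 2) L` for `L` the radial Laplacian and `E` the
Euler operator: the Laplacian is homogeneous of degree `-2`. -/
theorem radialLaplacian_eulerOperator_add {F : ℝ → ℝ} (hF : ContDiff ℝ ∞ F) (c : ℝ) :
    radialLaplacian n (eulerOperator n F + c • F) =
      eulerOperator n (radialLaplacian n F) + (c + 2) • radialLaplacian n F := by
  have h1 := contDiff_deriv hF
  have h2 := contDiff_deriv h1
  have h3 := contDiff_deriv h2
  have d0 : ∀ t, HasDerivAt F (deriv F t) t := fun t =>
    (hF.differentiable (by simp) t).hasDerivAt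
  have d1 : ∀ t, HasDerivAt (deriv F) (deriv (deriv F) t) t := fun t =>
    (h1.differentiable (by simp) t).hasDerivAt
  have d2 : ∀ t, HasDerivAt (deriv (deriv F)) (deriv (deriv (deriv F)) t) t := fun t =>
    (h2.differentiable (by simp) t).hasDerivAt
  have e1 : deriv (eulerOperator n F + c • F) =
      fun t => (n + 2 + c) * deriv F t + 2 * t * deriv (deriv F) t := by
    ext t
    have := (((d0 t).const_mul (n : ℝ)).add (((hasDerivAt_id t).const_mul 2).mul (d1 t))).add
      ((d0 t).const_mul c)
    refine (HasDerivAt.deriv (f := eulerOperator n F + c • F) this).trans ?_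
    simp only [id, mul_one]
    ring
  have e2 : deriv (fun t => (n + 2 + c) * deriv F t + 2 * t * deriv (deriv F) t) =
      fun t => (n + 4 + c) * deriv (deriv F) t + 2 * t * deriv (deriv (deriv F)) t := by
    ext t
    have := ((d1 t).const_mul (n + 2 + c : ℝ)).add (((hasDerivAt_id t).const_mul 2).mul (d2 t))
    refine (HasDerivAt.deriv (f := fun t => (n + 2 + c) * deriv F t + 2 * t * deriv (deriv F) t)
      this).trans ?_
    simp only [id, mul_one]
    ring
  have e3 : deriv (radialLaplacian n F) =
      fun t => (4 + 2 * n) * deriv (deriv F) t + 4 * t * deriv (deriv (deriv F)) t := by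
    ext t
    have := (((hasDerivAt_id t).const_mul 4).mul (d2 t)).add ((d1 t).const_mul (2 * n : ℝ))
    refine (HasDerivAt.deriv (f := radialLaplacian n F) this).trans ?_
    simp only [id, mul_one]
    ring
  ext t
  simp only [Pi.add_apply, Pi.smul_apply, smul_eq_mul]
  rw [radialLaplacian, e1, e2, eulerOperator, e3, radialLaplacian]
  ring

/-- One profile `G`, the primitive of `F / 2`, serves for all orders: `L^(i+1) G = (E + 2i) L^i F`,
with `L` the radial Laplacian and `E` the Euler operator. -/
theorem IsProfile.exists_iterate_radialLaplacian_eq (n : ℕ) {F : ℝ → ℝ} (hF : IsProfile F) :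
    ∃ G, IsProfile G ∧ ∀ i : ℕ, (_root_.radialLaplacian n)^[i + 1] G =
      eulerOperator n ((_root_.radialLaplacian n)^[i] F) +
        (2 * i : ℝ) • (_root_.radialLaplacian n)^[i] F := by
  obtain ⟨G, hG, hGF⟩ := hF.exists_radialLaplacian_eq_eulerOperator n
  refine ⟨G, hG, fun i => ?_⟩
  induction i with
  | zero => simp [hGF]
  | succ i ih =>
    rw [Function.iterate_succ_apply', ih,
      radialLaplacian_eulerOperator_add (hF.iterate_radialLaplacian i).1,
      Function.iterate_succ_apply' _ i F]
    push_cast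
    ring_nf

theorem laplacian_radial {F : ℝ → ℝ} (hF : ContDiff ℝ ∞ F) {c : ℝ} {φ : 𝓢(E, ℂ)}
    (hφ : ∀ x, φ x = (F (c * ‖x‖ ^ 2) : ℂ)) (x : E) :
    Δ φ x = ((c * radialLaplacian n F (c * ‖x‖ ^ 2) : ℝ) : ℂ) := by
  have h1 := contDiff_deriv hF
  have d0 : ∀ t, HasDerivAt F (deriv F t) t := fun t =>
    (hF.differentiable (by simp) t).hasDerivAt
  have d1 : ∀ t, HasDerivAt (deriv F) (deriv (deriv F) t) t := fun t =>
    (h1.differentiable (by simp) t).hasDerivAt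
  have hline : ∀ (x v : E), HasDerivAt (fun s : ℝ => x + s • v) v 0 := fun x v => by
    simpa using ((hasDerivAt_id (0 : ℝ)).smul_const v).const_add x
  have hnorm : ∀ (x v : E), HasDerivAt (fun s : ℝ => c * ‖x + s • v‖ ^ 2)
      (c * (2 * inner ℝ x v)) 0 := fun x v => by
    simpa using ((hline x v).norm_sq).const_mul c
  have hd : ∀ (v x : E), LineDeriv.lineDerivOp v φ x =
      ((deriv F (c * ‖x‖ ^ 2) * (c * (2 * inner ℝ x v)) : ℝ) : ℂ) := by
    intro v x
    rw [SchwartzMap.lineDerivOp_apply]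
    refine HasLineDerivAt.lineDeriv ?_
    have h : HasDerivAt (fun s : ℝ => F (c * ‖x + s • v‖ ^ 2))
        (deriv F (c * ‖x‖ ^ 2) * (c * (2 * inner ℝ x v))) 0 := by
      have := HasDerivAt.comp (0 : ℝ) (h₂ := F) (d0 (c * ‖x + (0 : ℝ) • v‖ ^ 2)) (hnorm x v)
      simpa [Function.comp_def] using this
    unfold HasLineDerivAt
    simpa only [hφ] using h.ofReal_comp
  have hdd : ∀ (v x : E), LineDeriv.lineDerivOp v (LineDeriv.lineDerivOp v φ) x =
      ((deriv (deriv F) (c * ‖x‖ ^ 2) * (c * (2 * inner ℝ x v)) * (c * (2 * inner ℝ x v)) +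
        deriv F (c * ‖x‖ ^ 2) * (c * (2 * inner ℝ v v)) : ℝ) : ℂ) := by
    intro v x
    rw [SchwartzMap.lineDerivOp_apply]
    refine HasLineDerivAt.lineDeriv ?_
    have h : HasDerivAt (fun s : ℝ => deriv F (c * ‖x + s • v‖ ^ 2))
        (deriv (deriv F) (c * ‖x‖ ^ 2) * (c * (2 * inner ℝ x v))) 0 := by
      have := HasDerivAt.comp (0 : ℝ) (h₂ := deriv F) (d1 (c * ‖x + (0 : ℝ) • v‖ ^ 2)) (hnorm x v)
      simpa [Function.comp_def] using this
    have h' : HasDerivAt (fun s : ℝ => c * (2 * inner ℝ (x + s • v) v))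
        (c * (2 * inner ℝ v v)) 0 := by
      have := (((hline x v).inner ℝ (hasDerivAt_const (0 : ℝ) v)).const_mul 2).const_mul c
      simpa using this
    unfold HasLineDerivAt
    have := (h.mul h').ofReal_comp
    simp only [hd]
    simp only [zero_smul, add_zero] at this
    exact this
  let b := EuclideanSpace.basisFun (Fin n) ℝ
  rw [SchwartzMap.laplacian_eq_sum b, sum_apply]
  simp only [hdd]
  rw [← Complex.ofReal_sum]
  congr 1
  have h2 := b.sum_sq_inner_left x
  have h3 : ∀ i, inner ℝ (b i) (b i) = (1 : ℝ) := fun i => by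
    rw [real_inner_self_eq_norm_sq, b.norm_eq_one]; norm_num
  simp only [h3, Finset.sum_add_distrib, Finset.sum_const, Finset.card_univ, Fintype.card_fin,
    nsmul_eq_mul]
  have h4 : ∀ i, deriv (deriv F) (c * ‖x‖ ^ 2) * (c * (2 * inner ℝ x (b i))) *
      (c * (2 * inner ℝ x (b i))) =
      deriv (deriv F) (c * ‖x‖ ^ 2) * (4 * c ^ 2) * (inner ℝ x (b i)) ^ 2 := fun i => by ring
  simp only [h4, ← Finset.mul_sum, h2, radialLaplacian]
  ring

/-! ### Radial averages of polyharmonic functions -/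

theorem IsProfile.exists_abs_le {F : ℝ → ℝ} (hF : IsProfile F) :
    ∃ M, 0 ≤ M ∧ ∀ t, 0 ≤ t → |F t| ≤ M := by
  obtain ⟨h, T, hT⟩ := hF
  obtain ⟨M, hM⟩ := (isCompact_Icc (a := (0 : ℝ)) (b := T)).exists_bound_of_continuousOn
    h.continuous.continuousOn
  refine ⟨max M 0, le_max_right _ _, fun t ht => ?_⟩
  rcases le_total t T with h1 | h1
  · exact (hM t ⟨ht, h1⟩).trans (le_max_left _ _)
  · simp [hT t h1]

theorem IsProfile.exists_eq_zero {F : ℝ → ℝ} (hF : IsProfile F) :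
    ∃ S, 0 < S ∧ ∀ R > 0, ∀ x : E, R * S ≤ ‖x‖ → F (‖x‖ ^ 2 / R ^ 2) = 0 := by
  obtain ⟨h, T, hT⟩ := hF
  refine ⟨|T| + 1, by positivity, fun R hR x hx => hT _ ?_⟩
  have h1 : |T| + 1 ≤ ‖x‖ / R := by rw [le_div_iff₀ hR]; linarith
  rw [← div_pow]
  nlinarith [le_abs_self T, abs_nonneg T]

theorem IsProfile.hasCompactSupport {F : ℝ → ℝ} (hF : IsProfile F) {R : ℝ} (hR : 0 < R) :
    HasCompactSupport fun x : E => F (‖x‖ ^ 2 / R ^ 2) := by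
  obtain ⟨S, -, h⟩ := hF.exists_eq_zero (n := n)
  refine HasCompactSupport.intro (isCompact_closedBall (0 : E) (R * S)) fun x hx => h R hR x ?_
  simp only [Metric.mem_closedBall, dist_zero_right, not_le] at hx
  exact hx.le

theorem radialLaplacian_const_mul (a : ℝ) (F : ℝ → ℝ) :
    radialLaplacian n (fun t => a * F t) = fun t => a * radialLaplacian n F t := by
  have h : deriv (fun t => a * F t) = fun t => a * deriv F t :=
    funext fun t => deriv_const_mul_field a
  ext t
  simp only [radialLaplacian, h, deriv_const_mul_field]
  ring

theorem iterate_laplacian_radial {F : ℝ → ℝ} (hF : ContDiff ℝ ∞ F) {c : ℝ} {φ : 𝓢(E, ℂ)}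
    (hφ : ∀ x, φ x = (F (c * ‖x‖ ^ 2) : ℂ)) (k : ℕ) (x : E) :
    (LineDeriv.laplacianCLM ℂ E 𝓢(E, ℂ) ^ k) φ x =
      ((c ^ k * (radialLaplacian n)^[k] F (c * ‖x‖ ^ 2) : ℝ) : ℂ) := by
  have hsm : ∀ k, ContDiff ℝ ∞ ((radialLaplacian n)^[k] F) := by
    intro k
    induction k with
    | zero => exact hF
    | succ k ih => rw [Function.iterate_succ_apply']; exact ih.radialLaplacian
  induction k generalizing x with
  | zero => simp [hφ]
  | succ k ih =>
    rw [pow_succ', mul_apply_eq_comp, SchwartzMap.laplacianCLM_eq,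
      laplacian_radial (F := fun t => c ^ k * (radialLaplacian n)^[k] F t)
        (by have := hsm k; fun_prop) ih, radialLaplacian_const_mul, Function.iterate_succ_apply']
    congr 1
    ring

/-- The integral of `h` against the radial function with profile `F` at scale `R`. -/
noncomputable def radialPairing (h : E → ℝ) (F : ℝ → ℝ) (R : ℝ) : ℝ :=
  ∫ x, h x * F (‖x‖ ^ 2 / R ^ 2)

theorem integrable_radial {h : E → ℝ} (hloc : LocallyIntegrable h volume) {F : ℝ → ℝ}
    (hF : IsProfile F) {R : ℝ} (hR : 0 < R) :
    Integrable fun x => h x * F (‖x‖ ^ 2 / R ^ 2) := by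
  have hc : Continuous fun x : E => F (‖x‖ ^ 2 / R ^ 2) := by
    have := hF.1.continuous
    fun_prop
  simpa [mul_comm] using
    hloc.integrable_smul_left_of_hasCompactSupport hc (hF.hasCompactSupport hR)

theorem radialPairing_iterate_eq_zero {h : E → ℝ} {k : ℕ}
    (hsol : ∀ φ : 𝓢(E, ℂ), HasCompactSupport φ →
      ∫ x, (h x : ℂ) * (LineDeriv.laplacianCLM ℂ E 𝓢(E, ℂ) ^ k) φ x = 0)
    {F : ℝ → ℝ} (hF : IsProfile F) {R : ℝ} (hR : 0 < R) :
    radialPairing h ((radialLaplacian n)^[k] F) R = 0 := by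
  have hs : HasCompactSupport fun x : E => (F (‖x‖ ^ 2 / R ^ 2) : ℂ) :=
    (hF.hasCompactSupport hR).comp_left (g := fun r : ℝ => (r : ℂ)) Complex.ofReal_zero
  have hd : ContDiff ℝ ∞ fun x : E => (F (‖x‖ ^ 2 / R ^ 2) : ℂ) := by
    have h1 : ContDiff ℝ ∞ fun x : E => ‖x‖ ^ 2 / R ^ 2 := (contDiff_norm_sq ℝ).div_const _
    exact Complex.ofRealCLM.contDiff.comp (hF.1.comp h1)
  have h0 := hsol (hs.toSchwartzMap hd) hs
  have h1 : ∀ x, hs.toSchwartzMap hd x = (F ((R ^ 2)⁻¹ * ‖x‖ ^ 2) : ℂ) := fun x => by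
    rw [inv_mul_eq_div]; rfl
  simp only [iterate_laplacian_radial hF.1 h1] at h0
  have h2 : ∀ x : E, (h x : ℂ) * (((R ^ 2)⁻¹ ^ k *
      (radialLaplacian n)^[k] F ((R ^ 2)⁻¹ * ‖x‖ ^ 2) : ℝ) : ℂ) =
      (((R ^ 2)⁻¹ ^ k * (h x * (radialLaplacian n)^[k] F (‖x‖ ^ 2 / R ^ 2)) : ℝ) : ℂ) := by
    intro x
    rw [inv_mul_eq_div (R ^ 2)]
    push_cast
    ring
  simp only [h2] at h0
  rw [integral_complex_ofReal, Complex.ofReal_eq_zero, integral_const_mul] at h0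
  exact (mul_eq_zero.1 h0).resolve_left (by positivity)

theorem hasDerivAt_radialPairing {h : E → ℝ} (hloc : LocallyIntegrable h volume) {F : ℝ → ℝ}
    (hF : IsProfile F) {R₀ : ℝ} (hR₀ : 0 < R₀) :
    HasDerivAt (radialPairing h F)
      ((n * radialPairing h F R₀ - radialPairing h (eulerOperator n F) R₀) / R₀) R₀ := by
  have hP : IsProfile fun t => t * deriv F t := by
    obtain ⟨h1, T, hT⟩ := hF.deriv
    exact ⟨contDiff_id.mul h1, T, fun t ht => by simp [hT t ht]⟩
  obtain ⟨M, hM0, hM⟩ := hP.exists_abs_le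
  obtain ⟨S, hS, hSz⟩ := hP.exists_eq_zero (n := n)
  have hmeas := hloc.aestronglyMeasurable
  have hball : ∀ R ∈ Metric.ball R₀ (R₀ / 2), R₀ / 2 < R ∧ R < 2 * R₀ := by
    intro R hR
    rw [Real.ball_eq_Ioo] at hR
    exact ⟨by linarith [hR.1], by linarith [hR.2]⟩
  have key := hasDerivAt_integral_of_dominated_loc_of_deriv_le (μ := (volume : Measure E))
    (F := fun R x => h x * F (‖x‖ ^ 2 / R ^ 2))
    (F' := fun R x => h x * (-2 / R * (‖x‖ ^ 2 / R ^ 2 * deriv F (‖x‖ ^ 2 / R ^ 2))))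
    (bound := (Metric.closedBall (0 : E) (2 * R₀ * S)).indicator fun x => |h x| * (4 / R₀ * M))
    (Metric.ball_mem_nhds R₀ (show 0 < R₀ / 2 by positivity))
    ?_ (integrable_radial hloc hF hR₀) ?_ ?_ ?_ ?_
  · have h1 := key.2
    refine h1.congr_deriv ?_
    have hE : ∀ x : E, h x * (-2 / R₀ * (‖x‖ ^ 2 / R₀ ^ 2 * deriv F (‖x‖ ^ 2 / R₀ ^ 2))) =
        (n * (h x * F (‖x‖ ^ 2 / R₀ ^ 2)) - h x * eulerOperator n F (‖x‖ ^ 2 / R₀ ^ 2)) / R₀ := by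
      intro x
      simp only [eulerOperator]
      ring
    have hEp : IsProfile (eulerOperator n F) := by
      obtain ⟨G, hG, h⟩ := hF.exists_radialLaplacian_eq_eulerOperator n
      exact h ▸ hG.radialLaplacian
    simp only [hE]
    rw [integral_div, integral_sub ((integrable_radial hloc hF hR₀).const_mul _)
      (integrable_radial hloc hEp hR₀), integral_const_mul]
    rfl
  · filter_upwards [lt_mem_nhds hR₀] with R hR
    exact (integrable_radial hloc hF hR).aestronglyMeasurable
  · have : Continuous fun x : E =>
        (-2 / R₀ * (‖x‖ ^ 2 / R₀ ^ 2 * deriv F (‖x‖ ^ 2 / R₀ ^ 2))) := by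
      have := hF.deriv.1.continuous
      fun_prop
    exact hmeas.mul this.aestronglyMeasurable
  · refine ae_of_all _ fun x R hR => ?_
    obtain ⟨h1, h2⟩ := hball R hR
    have hR0 : 0 < R := by linarith
    by_cases hx : x ∈ Metric.closedBall (0 : E) (2 * R₀ * S)
    · rw [Set.indicator_of_mem hx, norm_mul, norm_mul, Real.norm_eq_abs (h x)]
      have h3 : ‖-2 / R‖ ≤ 4 / R₀ := by
        rw [norm_div, Real.norm_of_nonneg hR0.le, div_le_div_iff₀ hR0 hR₀]
        norm_num
        linarith
      have h4 := hM (‖x‖ ^ 2 / R ^ 2) (by positivity)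
      rw [← Real.norm_eq_abs] at h4
      gcongr
    · rw [Set.indicator_of_notMem hx]
      simp only [Metric.mem_closedBall, dist_zero_right, not_le] at hx
      rw [hSz R hR0 x (by nlinarith)]
      simp
  · refine (integrable_indicator_iff measurableSet_closedBall).2 ?_
    exact ((hloc.integrableOn_isCompact (isCompact_closedBall _ _)).abs).mul_const _
  · refine ae_of_all _ fun x R hR => ?_
    have hR0 : R ≠ 0 := by have := (hball R hR).1; intro h; linarith
    have h1 : HasDerivAt (fun R : ℝ => ‖x‖ ^ 2 / R ^ 2) (-2 / R * (‖x‖ ^ 2 / R ^ 2)) R := by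
      have := ((hasDerivAt_pow 2 R).inv (by positivity)).const_mul (‖x‖ ^ 2)
      simp only [div_eq_mul_inv]
      refine this.congr_deriv ?_
      field_simp
      simp
      ring
    have h2 := (((hF.1.differentiable (by simp) (‖x‖ ^ 2 / R ^ 2)).hasDerivAt).comp R h1).const_mul
      (h x)
    refine h2.congr_deriv ?_
    ring

/-- Radial averages of a polyharmonic function of order `k` grow at most polynomially. The proof
descends from `i = k`, where the pairing vanishes, to smaller `i`, integrating
`(R^{-n-2i} A_{L^i F})' = - R^{-n-2i-1} A_{L^{i+1} G}`, where `A_F` is the pairing with `F`, `L` the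
radial Laplacian and `G` the primitive of `F / 2`. Pizzetti's formula gives the exponent
`n + 2k - 2`; the exponent here has one unit to spare, so that no step produces a logarithm. -/
theorem exists_abs_radialPairing_iterate_le {h : E → ℝ} (hloc : LocallyIntegrable h volume) {k : ℕ}
    (hsol : ∀ φ : 𝓢(E, ℂ), HasCompactSupport φ →
      ∫ x, (h x : ℂ) * (LineDeriv.laplacianCLM ℂ E 𝓢(E, ℂ) ^ k) φ x = 0)
    (j i : ℕ) (hij : i + j = k) {F : ℝ → ℝ} (hF : IsProfile F) :
    ∃ C, 0 ≤ C ∧ ∀ R, 1 ≤ R →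
      |radialPairing h ((radialLaplacian n)^[i] F) R| ≤ C * R ^ (n + 2 * k - 1) := by
  induction j generalizing i F with
  | zero =>
    refine ⟨0, le_rfl, fun R hR => ?_⟩
    rw [show i = k from hij, radialPairing_iterate_eq_zero hsol hF (by linarith)]
    simp
  | succ j ih =>
    obtain ⟨G, hG, hGF⟩ := hF.exists_iterate_radialLaplacian_eq n
    obtain ⟨C, hC, hbd⟩ := ih (i + 1) (by omega) hG
    set A := radialPairing h ((radialLaplacian n)^[i] F)
    set B := radialPairing h ((radialLaplacian n)^[i + 1] G)
    have hFi := hF.iterate_radialLaplacian (n := n) i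
    have hEp : IsProfile (eulerOperator n ((radialLaplacian n)^[i] F)) := by
      obtain ⟨G', hG', h'⟩ := hFi.exists_radialLaplacian_eq_eulerOperator n
      exact h' ▸ hG'.radialLaplacian
    have hA : ∀ R, 0 < R → HasDerivAt A (((n + 2 * i : ℕ) * A R - B R) / R) R := by
      intro R hR
      refine (hasDerivAt_radialPairing hloc hFi hR).congr_deriv ?_
      have hB : B R = radialPairing h (eulerOperator n ((radialLaplacian n)^[i] F)) R +
          2 * i * A R := by
        simp only [B, A, radialPairing, hGF i]
        rw [← integral_const_mul, ← integral_add (integrable_radial hloc hEp hR)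
          ((integrable_radial hloc hFi hR).const_mul _)]
        congr 1; ext x
        simp only [Pi.add_apply, Pi.smul_apply, smul_eq_mul]
        ring
      rw [hB]
      push_cast
      ring
    set q := n + 2 * i
    have hW : ∀ R, 0 < R → HasDerivAt (fun R => A R / R ^ q) (-(B R / R ^ (q + 1))) R := by
      intro R hR
      refine ((hA R hR).div (hasDerivAt_pow q R) (by positivity)).congr_deriv ?_
      rcases q with _ | q
      · simp; ring
      · simp only [Nat.add_sub_cancel]
        push_cast
        field_simp
        ring
    obtain ⟨d, hd⟩ : ∃ d, n + 2 * k - 1 = q + 1 + d := ⟨2 * j, by omega⟩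
    refine ⟨|A 1| + C, by positivity, fun R hR => ?_⟩
    have h1 : ∀ r ∈ Set.Icc 1 R, ‖-(B r / r ^ (q + 1))‖ ≤ C * R ^ d := by
      intro r hr
      have hr0 : 0 < r := by linarith [hr.1]
      rw [norm_neg, norm_div, Real.norm_eq_abs, Real.norm_of_nonneg (by positivity),
        div_le_iff₀ (by positivity)]
      refine (hbd r hr.1).trans ?_
      rw [hd, pow_add, mul_assoc, mul_comm (r ^ (q + 1))]
      gcongr
      exact hr.2
    have h2 := Convex.norm_image_sub_le_of_norm_hasDerivWithin_le
      (fun r hr => (hW r (by linarith [hr.1])).hasDerivWithinAt) h1 (convex_Icc 1 R)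
      (Set.left_mem_Icc.2 hR) (Set.right_mem_Icc.2 hR)
    have hRd : 1 ≤ R ^ (d + 1) := one_le_pow₀ hR
    have h3 : |A R| / R ^ q ≤ (|A 1| + C) * R ^ (d + 1) := by
      have e1 : |A R| / R ^ q = ‖A R / R ^ q‖ := by
        rw [norm_div, Real.norm_eq_abs, Real.norm_of_nonneg (by positivity)]
      have e2 : ‖A R / R ^ q‖ ≤ ‖A 1 / 1 ^ q‖ + ‖A R / R ^ q - A 1 / 1 ^ q‖ := by
        have := norm_add_le (A 1 / 1 ^ q) (A R / R ^ q - A 1 / 1 ^ q)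
        simpa using this
      rw [e1]
      refine e2.trans ?_
      rw [add_mul]
      refine add_le_add ?_ (h2.trans ?_)
      · rw [one_pow, div_one, Real.norm_eq_abs]
        exact le_mul_of_one_le_right (abs_nonneg _) hRd
      · rw [Real.norm_of_nonneg (by linarith), pow_succ, ← mul_assoc]
        gcongr
        linarith
    rw [div_le_iff₀ (by positivity)] at h3
    refine h3.trans (le_of_eq ?_)
    rw [hd]
    ring

/-! ### From the one-sided bound to the growth condition -/

/-- Away from the unit ball, the weighted exponential and the logarithm in the upper bound are
replaced by an integrable function plus a function of linear growth. -/
theorem le_add_of_le_logarithmic (hn : 1 ≤ n) {α C h u : ℝ} {x : E} (hx : 1 ≤ ‖x‖)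
    (hb : h ≤ u + C * Real.log (1 + ‖x‖) + C) :
    h ≤ ‖x‖ ^ ((n : ℝ) * α) * Real.exp (n * u) + (|α| + |C|) * (1 + ‖x‖) := by
  have hx0 : 0 < ‖x‖ := by linarith
  have hn' : (1 : ℝ) ≤ n := by exact_mod_cast hn
  set w := ‖x‖ ^ ((n : ℝ) * α) * Real.exp (n * u)
  have hw : 0 < w := by positivity
  have hlog : Real.log w = n * α * Real.log ‖x‖ + n * u := by
    rw [Real.log_mul (by positivity) (by positivity), Real.log_rpow hx0, Real.log_exp]
  have h1 : Real.log w ≤ w := (Real.log_le_sub_one_of_pos hw).trans (by linarith)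
  have h2 : 0 ≤ Real.log ‖x‖ := Real.log_nonneg hx
  have h3 : Real.log ‖x‖ ≤ ‖x‖ := (Real.log_le_sub_one_of_pos hx0).trans (by linarith)
  have h4 : 0 ≤ Real.log (1 + ‖x‖) := Real.log_nonneg (by linarith)
  have h5 : Real.log (1 + ‖x‖) ≤ ‖x‖ :=
    (Real.log_le_sub_one_of_pos (by linarith)).trans (by linarith)
  have h6 : u ≤ w + |α| * ‖x‖ := by
    have e1 : -α * Real.log ‖x‖ ≤ |α| * ‖x‖ :=
      mul_le_mul (neg_le_abs α) h3 h2 (abs_nonneg α)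
    have e2 : (n : ℝ) * (u + α * Real.log ‖x‖) ≤ w := by linarith
    have e3 : u + α * Real.log ‖x‖ ≤ w := by
      rcases le_total 0 (u + α * Real.log ‖x‖) with h | h
      · nlinarith
      · linarith
    linarith
  have h7 : C * Real.log (1 + ‖x‖) ≤ |C| * ‖x‖ :=
    mul_le_mul (le_abs_self C) h5 h4 (abs_nonneg C)
  nlinarith [le_abs_self C, abs_nonneg α]

theorem exists_integral_posPart_le (hn : 1 ≤ n) {α C : ℝ} {h u : E → ℝ}
    (hloc : LocallyIntegrable h volume)
    (hw : Integrable (fun x => ‖x‖ ^ ((n : ℝ) * α) * Real.exp ((n : ℝ) * u x)) volume)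
    (hb : ∀ᵐ x ∂volume, h x ≤ u x + C * Real.log (1 + ‖x‖) + C) :
    ∃ D, 0 ≤ D ∧ ∀ R, 1 ≤ R →
      ∫ x in Metric.closedBall (0 : E) R, max (h x) 0 ≤ D * R ^ (n + 1) := by
  set w : E → ℝ := fun x => ‖x‖ ^ ((n : ℝ) * α) * Real.exp ((n : ℝ) * u x) with hwdef
  have hw0 : ∀ x, 0 ≤ w x := fun x => by positivity
  set K := |α| + |C|
  have hK : 0 ≤ K := by positivity
  set B₁ := Metric.closedBall (0 : E) 1
  have hB₁ : IntegrableOn (fun x => |h x|) B₁ :=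
    (hloc.integrableOn_isCompact (isCompact_closedBall _ _)).abs
  have hi : Integrable (B₁.indicator fun x => |h x|) :=
    (integrable_indicator_iff measurableSet_closedBall).2 hB₁
  set a := ∫ x, B₁.indicator (fun x => |h x|) x
  set b := ∫ x, w x
  set V := volume.real B₁
  have ha : 0 ≤ a := integral_nonneg fun x => Set.indicator_nonneg (fun _ _ => abs_nonneg _) x
  have hb0 : 0 ≤ b := integral_nonneg hw0
  have hV : 0 ≤ V := measureReal_nonneg
  refine ⟨a + b + 2 * K * V, by positivity, fun R hR => ?_⟩
  have hR0 : 0 < R := by linarith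
  set B := Metric.closedBall (0 : E) R with hB
  have hBfin : volume B ≠ ⊤ := (isCompact_closedBall (0 : E) R).measure_lt_top.ne
  have hVR : volume.real B = R ^ n * V := by
    rw [hB, Measure.real, Measure.addHaar_closedBall' volume (0 : E) hR0.le, ENNReal.toReal_mul,
      ENNReal.toReal_ofReal (by positivity), finrank_euclideanSpace_fin]
    rfl
  have hiw : Integrable fun x => B₁.indicator (fun x => |h x|) x + w x := hi.add hw
  have hint : IntegrableOn (fun x => B₁.indicator (fun x => |h x|) x + w x + K * (1 + R)) B :=
    hiw.integrableOn.add (integrableOn_const hBfin)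
  calc ∫ x in B, max (h x) 0
      ≤ ∫ x in B, (B₁.indicator (fun x => |h x|) x + w x + K * (1 + R)) := by
        refine setIntegral_mono_on_ae
          ((hloc.integrableOn_isCompact (isCompact_closedBall _ _)).sup (integrable_zero _ _ _))
          hint measurableSet_closedBall ?_
        filter_upwards [hb] with x hx hxB
        simp only [hB, Metric.mem_closedBall, dist_zero_right] at hxB
        have hKR : 0 ≤ K * (1 + R) := by positivity
        rcases le_total ‖x‖ 1 with h1 | h1
        · rw [Set.indicator_of_mem (show x ∈ B₁ by simpa [B₁] using h1)]
          have := hw0 x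
          exact max_le (by linarith [le_abs_self (h x)]) (by linarith [abs_nonneg (h x)])
        · have h2 : 0 ≤ B₁.indicator (fun x => |h x|) x :=
            Set.indicator_nonneg (fun _ _ => abs_nonneg _) x
          have h3 := le_add_of_le_logarithmic hn (α := α) h1 hx
          have h4 : K * (1 + ‖x‖) ≤ K * (1 + R) := by gcongr
          have := hw0 x
          refine max_le ?_ (by linarith)
          simp only [hwdef] at *
          linarith
    _ ≤ a + b + K * (1 + R) * (R ^ n * V) := by
        rw [integral_add hiw.integrableOn (integrableOn_const hBfin),
          integral_add hi.integrableOn hw.integrableOn, setIntegral_const, hVR, smul_eq_mul]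
        have e1 := setIntegral_le_integral (s := B) hi
          (ae_of_all _ fun x => Set.indicator_nonneg (fun _ _ => abs_nonneg _) x)
        have e2 := setIntegral_le_integral (s := B) hw (ae_of_all _ hw0)
        linarith
    _ ≤ (a + b + 2 * K * V) * R ^ (n + 1) := by
        have h1 : 1 ≤ R ^ (n + 1) := one_le_pow₀ hR
        have h2 : K * (1 + R) * (R ^ n * V) ≤ K * (2 * R) * (R ^ n * V) := by
          gcongr
          linarith
        have h3 : K * (2 * R) * (R ^ n * V) = 2 * K * V * R ^ (n + 1) := by ring
        nlinarith

theorem exists_integral_abs_le {h : E → ℝ} (hloc : LocallyIntegrable h volume) {k : ℕ}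
    (hk : 1 ≤ k)
    (hsol : ∀ φ : 𝓢(E, ℂ), HasCompactSupport φ →
      ∫ x, (h x : ℂ) * (LineDeriv.laplacianCLM ℂ E 𝓢(E, ℂ) ^ k) φ x = 0)
    (hpos : ∃ D, 0 ≤ D ∧ ∀ R, 1 ≤ R →
      ∫ x in Metric.closedBall (0 : E) R, max (h x) 0 ≤ D * R ^ (n + 1)) :
    ∃ C, 0 ≤ C ∧ ∀ R, 1 ≤ R →
      ∫ x in Metric.closedBall (0 : E) R, |h x| ≤ C * R ^ (n + 2 * k - 1) := by
  let F : ℝ → ℝ := fun t => Real.smoothTransition (2 - t)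
  have hF : IsProfile F := ⟨Real.smoothTransition.contDiff.comp (contDiff_const.sub contDiff_id), 2,
    fun t ht => Real.smoothTransition.zero_of_nonpos (by linarith)⟩
  obtain ⟨C, hC, hbd⟩ := exists_abs_radialPairing_iterate_le hloc hsol k 0 (by omega) hF
  obtain ⟨D, hD, hD'⟩ := hpos
  refine ⟨2 * (D * 2 ^ (n + 1)) + C, by positivity, fun R hR => ?_⟩
  have hR0 : 0 < R := by linarith
  have hposi : IntegrableOn (fun x => max (h x) 0) (Metric.closedBall (0 : E) (2 * R)) :=
    (hloc.integrableOn_isCompact (isCompact_closedBall _ _)).sup (integrable_zero _ _ _)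
  have hposi' := (integrable_indicator_iff (f := fun x => max (h x) 0)
    (measurableSet_closedBall (x := (0 : E)) (ε := 2 * R))).2 hposi
  have hrad := integrable_radial hloc hF hR0
  have habs : IntegrableOn (fun x => |h x|) (Metric.closedBall (0 : E) R) :=
    (hloc.integrableOn_isCompact (isCompact_closedBall _ _)).abs
  have habs' := (integrable_indicator_iff (f := fun x => |h x|)
    (measurableSet_closedBall (x := (0 : E)) (ε := R))).2 habs
  calc ∫ x in Metric.closedBall (0 : E) R, |h x|
      = ∫ x, (Metric.closedBall (0 : E) R).indicator (fun x => |h x|) x :=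
        (integral_indicator measurableSet_closedBall).symm
    -- The profile `F` is `1` on the ball of radius `R` and supported in that of radius `2 * R`;
    -- the pointwise inequality follows from `|h| = 2 * max h 0 - h`.
    _ ≤ ∫ x, (2 * (Metric.closedBall (0 : E) (2 * R)).indicator (fun x => max (h x) 0) x -
          h x * F (‖x‖ ^ 2 / R ^ 2)) := by
        refine integral_mono habs' ((hposi'.const_mul 2).sub hrad) fun x => ?_
        have hF0 : 0 ≤ F (‖x‖ ^ 2 / R ^ 2) := Real.smoothTransition.nonneg _
        have hF1 : F (‖x‖ ^ 2 / R ^ 2) ≤ 1 := Real.smoothTransition.le_one _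
        by_cases hx : x ∈ Metric.closedBall (0 : E) R
        · have hx2 : x ∈ Metric.closedBall (0 : E) (2 * R) :=
            Metric.closedBall_subset_closedBall (by linarith) hx
          have h1 : F (‖x‖ ^ 2 / R ^ 2) = 1 := by
            refine Real.smoothTransition.one_of_one_le ?_
            have : ‖x‖ ^ 2 / R ^ 2 ≤ 1 := by
              rw [div_le_one (by positivity)]
              gcongr
              simpa using hx
            linarith
          simp only [Set.indicator_of_mem hx, Set.indicator_of_mem hx2, h1, mul_one]
          rcases le_total 0 (h x) with h2 | h2
          · rw [abs_of_nonneg h2, max_eq_left h2]; linarith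
          · rw [abs_of_nonpos h2, max_eq_right h2]; linarith
        · simp only [Set.indicator_of_notMem hx]
          by_cases hx2 : x ∈ Metric.closedBall (0 : E) (2 * R)
          · simp only [Set.indicator_of_mem hx2]
            rcases le_total 0 (h x) with h2 | h2
            · rw [max_eq_left h2]; nlinarith
            · rw [max_eq_right h2]; nlinarith
          · have h1 : F (‖x‖ ^ 2 / R ^ 2) = 0 := by
              refine Real.smoothTransition.zero_of_nonpos ?_
              have : 2 ≤ ‖x‖ ^ 2 / R ^ 2 := by
                simp only [Metric.mem_closedBall, dist_zero_right, not_le] at hx2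
                rw [le_div_iff₀ (by positivity)]
                nlinarith
              linarith
            simp [Set.indicator_of_notMem hx2, h1]
    _ = 2 * (∫ x in Metric.closedBall (0 : E) (2 * R), max (h x) 0) - radialPairing h F R := by
        rw [integral_sub (hposi'.const_mul 2) hrad, integral_const_mul,
          integral_indicator measurableSet_closedBall]
        rfl
    _ ≤ 2 * (D * (2 * R) ^ (n + 1)) + C * R ^ (n + 2 * k - 1) := by
        have h1 := hD' (2 * R) (by linarith)
        have h2 := (neg_le_abs _).trans (hbd R hR)
        simp only [Function.iterate_zero, id] at h2
        linarith
    _ ≤ _ := by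
        have h1 : R ^ (n + 1) ≤ R ^ (n + 2 * k - 1) := pow_le_pow_right₀ hR (by omega)
        rw [mul_pow, add_mul]
        have : 2 * (D * (2 ^ (n + 1) * R ^ (n + 1))) ≤
            2 * (D * 2 ^ (n + 1)) * R ^ (n + 2 * k - 1) := by
          calc _ = 2 * (D * 2 ^ (n + 1)) * R ^ (n + 1) := by ring
            _ ≤ _ := by gcongr
        linarith

/-- Growth `R ^ a` of the integrals of `|h|` over balls makes `|h|` integrable against
`(1 + ‖x‖) ^ (-(a + 1))`, by summation over dyadic annuli. -/
theorem integrable_abs_div_of_growth {h : E → ℝ} (hloc : LocallyIntegrable h volume) {a : ℕ} {C : ℝ}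
    (hC : ∀ R, 1 ≤ R → ∫ x in Metric.closedBall (0 : E) R, |h x| ≤ C * R ^ a) :
    Integrable (fun x => |h x| / (1 + ‖x‖) ^ (a + 1)) := by
  set f : E → ℝ := fun x => |h x| / (1 + ‖x‖) ^ (a + 1) with hf
  have hf0 : ∀ x, 0 ≤ f x := fun x => by positivity
  have hmeas : AEStronglyMeasurable f volume :=
    (hloc.aestronglyMeasurable.norm.aemeasurable.div (by fun_prop)).aestronglyMeasurable
  have habs : ∀ R, IntegrableOn (fun x => |h x|) (Metric.closedBall (0 : E) R) := fun R =>
    (hloc.integrableOn_isCompact (isCompact_closedBall _ _)).abs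
  have hfi : ∀ R, IntegrableOn f (Metric.closedBall (0 : E) R) := fun R =>
    Integrable.mono' (habs R) hmeas.restrict (ae_of_all _ fun x => by
      rw [Real.norm_of_nonneg (hf0 x)]
      exact div_le_self (abs_nonneg _) (one_le_pow₀ (by linarith [norm_nonneg x])))
  have hstep : ∀ N : ℕ, ∫ x in Metric.closedBall (0 : E) (2 ^ N), f x ≤
      C + 2 * (C * 2 ^ a) * (1 - (2 ^ N)⁻¹) := by
    intro N
    induction N with
    | zero =>
      refine (setIntegral_mono (hfi _) (habs _) fun x => ?_).trans ((hC _ (by norm_num)).trans ?_)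
      · exact div_le_self (abs_nonneg _) (one_le_pow₀ (by linarith [norm_nonneg x]))
      · simp
    | succ N ih =>
      have hsub : Metric.closedBall (0 : E) (2 ^ N) ⊆ Metric.closedBall 0 (2 ^ (N + 1)) :=
        Metric.closedBall_subset_closedBall (by gcongr <;> norm_num)
      have h1 : ∫ x in Metric.closedBall (0 : E) (2 ^ (N + 1)) \ Metric.closedBall 0 (2 ^ N), f x ≤
          C * 2 ^ a * (2 ^ N)⁻¹ := by
        calc _ ≤ ∫ x in Metric.closedBall (0 : E) (2 ^ (N + 1)) \ Metric.closedBall 0 (2 ^ N),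
              |h x| / (2 ^ N) ^ (a + 1) := by
              refine setIntegral_mono_on ((hfi _).mono_set Set.sdiff_subset)
                (((habs _).mono_set Set.sdiff_subset).div_const _)
                (measurableSet_closedBall.diff measurableSet_closedBall) fun x hx => ?_
              have : 2 ^ N ≤ 1 + ‖x‖ := by
                have := hx.2
                simp only [Metric.mem_closedBall, dist_zero_right, not_le] at this
                linarith
              simp only [hf]
              gcongr
          _ ≤ ∫ x in Metric.closedBall (0 : E) (2 ^ (N + 1)), |h x| / (2 ^ N) ^ (a + 1) :=
              setIntegral_mono_set ((habs _).div_const _)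
                (ae_of_all _ fun x => by positivity) (ae_of_all _ Set.sdiff_subset)
          _ = (∫ x in Metric.closedBall (0 : E) (2 ^ (N + 1)), |h x|) / (2 ^ N) ^ (a + 1) :=
              integral_div _ _
          _ ≤ C * (2 ^ (N + 1)) ^ a / (2 ^ N) ^ (a + 1) := by
              gcongr
              exact hC _ (one_le_pow₀ (by norm_num))
          _ = _ := by
              field_simp
              ring
      rw [← Set.sdiff_union_of_subset hsub, setIntegral_union Set.disjoint_sdiff_left
        measurableSet_closedBall ((hfi _).mono_set Set.sdiff_subset) (hfi _)]
      refine (add_le_add h1 ih).trans (le_of_eq ?_)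
      rw [pow_succ]
      field_simp
      ring
  have hCnn : 0 ≤ C := by
    have := (integral_nonneg (fun x => abs_nonneg (h x))).trans (hC 1 le_rfl)
    simpa using this
  have hcover : AECover (volume : Measure E) Filter.atTop
      fun N : ℕ => Metric.closedBall (0 : E) (2 ^ N) :=
    aecover_closedBall (tendsto_pow_atTop_atTop_of_one_lt one_lt_two)
  refine hcover.integrable_of_integral_norm_bounded (C + 2 * (C * 2 ^ a)) (fun N => hfi _)
    (Filter.Eventually.of_forall fun N => ?_)
  simp only [Real.norm_of_nonneg (hf0 _)]
  refine (hstep N).trans ?_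
  have h1 : 0 ≤ ((2 : ℝ) ^ N)⁻¹ := by positivity
  have h2 : 0 ≤ 2 * (C * 2 ^ a) := by positivity
  nlinarith

end

/-! ### Solutions with a one-sided bound are polynomials -/

theorem theoremA4 (n m : ℕ) (hn : 1 ≤ n) (hm : 1 ≤ m) (α : ℝ) (hα : -1 < α)
    (h : EuclideanSpace ℝ (Fin n) → ℝ)
    (hsol : IsSolution m h 0)
    (hbound : Even m → ∃ (u : EuclideanSpace ℝ (Fin n) → ℝ) (C : ℝ),
      Integrable (fun x => ‖x‖ ^ ((n : ℝ) * α) * Real.exp ((n : ℝ) * u x)) volume ∧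
      ∀ᵐ x ∂volume, h x ≤ u x + C * Real.log (1 + ‖x‖) + C) :
    ∃ p : MvPolynomial (Fin n) ℝ, p.totalDegree ≤ m - 1 ∧
      ∀ᵐ x ∂volume, h x = MvPolynomial.eval (fun i => x i) p := by
  obtain ⟨m, rfl⟩ : ∃ m', m = m' + 1 := ⟨m - 1, by omega⟩
  rw [Nat.add_sub_cancel]
  rcases Nat.even_or_odd (m + 1) with he | ho
  · obtain ⟨hloc, hT⟩ := hsol.1 he
    obtain ⟨u, C, hw, hb⟩ := hbound he
    obtain ⟨k, hk⟩ : ∃ k, m + 1 = 2 * k := he.two_dvd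
    have hlap : ∀ φ : 𝓢(EuclideanSpace ℝ (Fin n), ℂ), HasCompactSupport φ → ∫ x, (h x : ℂ) *
        (LineDeriv.laplacianCLM ℂ (EuclideanSpace ℝ (Fin n))
          𝓢(EuclideanSpace ℝ (Fin n), ℂ) ^ k) φ x = 0 := by
      intro φ hφ
      have h1 := hT φ hφ
      rw [hk, fracLaplacian_two_mul] at h1
      simp only [Pi.smul_apply, smul_eq_mul, mul_left_comm _ ((-1 : ℂ) ^ k)] at h1
      rw [integral_const_mul] at h1
      exact (mul_eq_zero.1 h1).resolve_left (by simp)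
    obtain ⟨D, -, hD⟩ := exists_integral_abs_le hloc (by omega) hlap
      (exists_integral_posPart_le hn hloc hw hb)
    have hI : Integrable (fun x => |h x| / (1 + ‖x‖) ^ (n + (m + 1))) := by
      have := integrable_abs_div_of_growth hloc hD
      rwa [show n + 2 * k - 1 + 1 = n + (m + 1) by omega] at this
    refine exists_polynomial_of_fracLaplacian_eq_zero hloc hI fun φ => ?_
    have h1 := integral_mul_clm_eq_zero_of_hasCompactSupport hloc.aestronglyMeasurable hI _ hlap φ
    rw [hk, fracLaplacian_two_mul]
    simp only [Pi.smul_apply, smul_eq_mul, mul_left_comm _ ((-1 : ℂ) ^ k)]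
    rw [integral_const_mul, h1, mul_zero]
  · obtain ⟨⟨hloc, hI⟩, hT⟩ := hsol.2 ho
    refine exists_polynomial_of_fracLaplacian_eq_zero hloc ?_ hT
    refine Integrable.mono' hI ?_ (ae_of_all _ fun x => ?_)
    · exact (hloc.aestronglyMeasurable.norm.aemeasurable.div (by fun_prop)).aestronglyMeasurable
    · rw [Real.norm_of_nonneg (by positivity)]
      have h1 : (n : ℝ) + 2 * (((m + 1 : ℕ) : ℝ) / 2) = ((n + (m + 1) : ℕ) : ℝ) := by
        push_cast; ring
      rw [h1, Real.rpow_natCast]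
      gcongr
      have := pow_add_pow_le (zero_le_one) (norm_nonneg x) (show n + (m + 1) ≠ 0 by omega)
      simpa using this
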